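/- Let $\mathcal X,\mathcal Y,\mathcal Z$ be finite sets, let $\mathsf P$ be a probability distribution on $\mathcal X\times\mathcal Z$, and let $d:\mathcal X\times\mathcal Y\to[0,\infty)$ be such that for every $x\in\mathcal X$ there is $y\in\mathcal Y$ with $d(x,y)=0$. Put $d^{(n)}(x^n,y^n)=\frac1n\sum_{i=1}^n d(x_i,y_i)$ and fix $D\ge 0$. For each $n\ge1$ let $(X_1,Z_1),\dots,(X_n,Z_n)$ be i.i.d. with law $\mathsf P$; $X^n$ is the enrollment and $Z^n$ the side information known to an adversary. A strategy $\mathcal S^{(n)}_Z$ assigns to every $z^n\in\mathcal Z^n$ an ordered set $y^n_z(1),y^n_z(2),\dots$ of distinct sequences (guesses) in $\mathcal Y^n$. Let $G^{(n)}(x^n|z^n)$ be the least $j$ with $d^{(n)}(x^n,y^n_z(j))\le D$, or $\infty$ if there is none. The deception (guessing) exponent is $$E_Z(D)=\liminf_{n\to\infty}\frac1n\min_{\mathcal S^{(n)}_Z}\log\mathbb E_{\mathsf P}\big[G^{(n)}(X^n|Z^n)\big].$$ For a probability distribution $\mathsf Q$ on $\mathcal X\times\mathcal Z$ let $$R_{X|Z}(D,\mathsf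 Q)=\min_{W(y|x,z)\,:\,\mathbb E[d(X,Y)]\le D} I(X;Y|Z)$$ be the conditional rate-distortion function with side information at both encoder and decoder, where $(X,Z)$ has law $\mathsf Q$ and $Y$ has conditional law $W(\cdot|x,z)$ given $(X,Z)=(x,z)$, and let $D(\mathsf Q\|\mathsf P)\in[0,\infty]$ be the relative entropy (all logarithms are natural). Then the minimum defining $R_{X|Z}(D,\mathsf Q)$ is attained for every $\mathsf Q$, and $$E_Z(D)=\max_{\mathsf Q}\big[R_{X|Z}(D,\mathsf Q)-D(\mathsf Q\|\mathsf P)\big],$$ where the maximum is over all probability distributions $\mathsf Q$ on $\mathcal X\times\mathcal Z$ and is attained. -/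

import Mathlib

open scoped ENNReal BigOperators

namespace SideInfoGuessing

noncomputable section

/-- Component-wise mean distortion `(1/n) ∑ i, d (x i) (y i)` between two length-`n` sequences. -/
def meanDist {X Y : Type*} (d : X → Y → ℝ) {n : ℕ} (x : Fin n → X) (y : Fin n → Y) : ℝ :=
  (1 / (n : ℝ)) * ∑ i, d (x i) (y i)

/-- An ordered set of guesses of length `n`: a list of sequences in `Y^n` without repetition. -/
abbrev GuessList (Y : Type*) (n : ℕ) : Type _ := {l : List (Fin n → Y) // l.Nodup}

/-- A strategy of an adversary with side information: an ordered set of guesses for every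
side-information sequence `z`. -/
abbrev Strategy (Y Z : Type*) (n : ℕ) : Type _ := (Fin n → Z) → GuessList Y n

/-- The counting function: the (one-based) index of the first guess in the list that lies within
distortion `D` of `x`, and `∞` (the infimum of the empty set) if there is no such guess. -/
def count {X Y : Type*} (d : X → Y → ℝ) (D : ℝ) {n : ℕ} (S : GuessList Y n)
    (x : Fin n → X) : ℝ≥0∞ :=
  ⨅ (j : Fin S.1.length) (_ : meanDist d x (S.1.get j) ≤ D), ((j : ℕ) : ℝ≥0∞) + 1

/-- Expected value of the counting function `G(X^n | Z^n)`, where the pairs `(X_i, Z_i)` are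
i.i.d. with law `P`. -/
def expectedCount {X Y Z : Type*} [Fintype X] [Fintype Z] (d : X → Y → ℝ) (D : ℝ)
    (P : PMF (X × Z)) {n : ℕ} (S : Strategy Y Z n) : ℝ≥0∞ :=
  ∑ x : Fin n → X, ∑ z : Fin n → Z, (∏ i, P (x i, z i)) * count d D (S z) x

/-- The deception exponent with side information,
`liminf (1/n) min_S log E[G(X^n | Z^n)]`. The minimum is over all strategies of length `n`; they
form a nonempty finite set when `Y` and `Z` are finite. -/
def deceptionExponent {X Y Z : Type*} [Fintype X] [Fintype Z] (d : X → Y → ℝ) (D : ℝ)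
    (P : PMF (X × Z)) : EReal :=
  Filter.liminf
    (fun n : ℕ => (((1 / (n : ℝ) : ℝ)) : EReal) *
      ⨅ S : Strategy Y Z n, ENNReal.log (expectedCount d D P S))
    Filter.atTop

/-- Joint mass function of `(X, Z, Y)` when `(X, Z)` has law `Q` and `Y` has conditional law
`W x z` given `(X, Z) = (x, z)`. -/
def jointMass {X Y Z : Type*} (Q : PMF (X × Z)) (W : X → Z → PMF Y) (x : X) (z : Z) (y : Y) : ℝ :=
  (Q (x, z)).toReal * (W x z y).toReal

/-- Conditional mutual information `I(X; Y | Z)` (in nats) of a joint mass function `p x z y`,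
`∑ p(x,z,y) log (p(x,z,y) p(z) / (p(x,z) p(z,y)))`; terms with `p(x,z,y) = 0` vanish. -/
def condMutualInfo {X Y Z : Type*} [Fintype X] [Fintype Y] [Fintype Z] (p : X → Z → Y → ℝ) : ℝ :=
  ∑ x, ∑ z, ∑ y, p x z y *
    Real.log ((p x z y * ∑ x', ∑ y', p x' z y') / ((∑ y', p x z y') * ∑ x', p x' z y))

/-- Expected distortion `E[d(X, Y)]` under a joint mass function `p x z y`. -/
def expectedDist {X Y Z : Type*} [Fintype X] [Fintype Y] [Fintype Z] (d : X → Y → ℝ)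
    (p : X → Z → Y → ℝ) : ℝ :=
  ∑ x, ∑ z, ∑ y, p x z y * d x y

/-- The values `I(X; Y | Z)` over all conditional laws `W` of `Y` given `(X, Z)` that satisfy
`E[d(X, Y)] ≤ D`, where `(X, Z)` has law `Q`. -/
def feasibleInfo {X Y Z : Type*} [Fintype X] [Fintype Y] [Fintype Z] (d : X → Y → ℝ) (D : ℝ)
    (Q : PMF (X × Z)) : Set EReal :=
  {r | ∃ W : X → Z → PMF Y, expectedDist d (jointMass Q W) ≤ D ∧
    r = (condMutualInfo (jointMass Q W) : EReal)}

/-- The conditional rate-distortion function `R_{X|Z}(D, Q)`, with side information at both the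
encoder and the decoder. -/
def condRateDist {X Y Z : Type*} [Fintype X] [Fintype Y] [Fintype Z] (d : X → Y → ℝ) (D : ℝ)
    (Q : PMF (X × Z)) : EReal :=
  sInf (feasibleInfo d D Q)

/-- Relative entropy `D(Q ‖ P)` (in nats, possibly `∞`) of two laws, with all sets measurable. -/
def relEntropy {α : Type*} (Q P : PMF α) : ℝ≥0∞ :=
  @InformationTheory.klDiv α ⊤ (@PMF.toMeasure α ⊤ Q) (@PMF.toMeasure α ⊤ P)

end

end SideInfoGuessing

/-!
The proof is by the method of types. Sequences are sorted by their letter counts `cnt`. A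
conditional type class is an orbit of the permutations that fix the conditioning sequence, so its
size is a ratio of products of factorials (`card_condClass`), and Stirling's formula turns every
logarithm of such a size into entropies, up to an error `O(log n)`. In particular the conditional
mutual information of a joint type of `(x, z, y)` is, up to this error, `1 / n` times the
logarithm of a ratio of class sizes (`abs_log_factorials_sub_infoFn_le`), and that same ratio has
two meanings.

* It bounds from above how many members of the class of `y` given `z` are needed to cover the
  class of `x` given `z`, by a greedy choice (`exists_cover_sideClass`). An adversary who lists
  such covers for all joint types, the small ones first, finds a sequence of joint type `k` with
  `z` after about `exp (n R(D, k / n))` guesses (`eventually_exists_strategy`).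

* Its inverse bounds the fraction of the class of `x` given `z` that one guess can cover
  (`card_covered_le`), so no list of guesses can do better on average over this class
  (`eventually_le_expectedCount`).

A type class with empirical distribution `q` has probability about `exp (-n D(q ‖ P))`, and there
are only polynomially many types; hence the exponent is the maximum of `R(D, q) - D(q ‖ P)`.

The limit arguments rest on the continuity of `R(D, ·)`, which for `D = 0` cannot come from
varying `D`. It comes from `complete`: whenever a joint mass function has to be adjusted to
another marginal, or rounded to a type, every entry is lowered and the remainder goes to a letter
that reproduces `x` without distortion. This never violates the constraint. Couplings, rather than
conditional laws, are used throughout, because they form a compact set on which mutual information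
is continuous.
-/

namespace SideInfoGuessing

open Finset

/-! ### Types of sequences -/

open Classical in
/-- The number of occurrences of the letter `a` in the sequence `w`; as a function of `a` this is
the (unnormalized) empirical distribution, or type, of `w`. -/
noncomputable def cnt {ι A : Type*} [Fintype ι] (w : ι → A) (a : A) : ℕ := #{i | w i = a}

section Types

variable {ι A B : Type*} [Fintype ι]

theorem cnt_eq_natCard (w : ι → A) (a : A) : cnt w a = Nat.card {i // w i = a} := by
  classical
  rw [Nat.card_eq_fintype_card, Fintype.card_subtype, cnt]

theorem cnt_eq_ncard (w : ι → A) (a : A) : cnt w a = Set.ncard {i | w i = a} :=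
  cnt_eq_natCard w a

theorem cnt_le (w : ι → A) (a : A) : cnt w a ≤ Fintype.card ι := Finset.card_le_univ _

theorem cnt_eq_zero_iff (w : ι → A) (a : A) : cnt w a = 0 ↔ ∀ i, w i ≠ a := by
  classical
  simp [cnt, filter_eq_empty_iff]

theorem sum_comp_eq_sum_cnt [Fintype A] (w : ι → A) (f : A → ℝ) :
    ∑ i, f (w i) = ∑ a, (cnt w a : ℝ) * f a := by
  classical
  rw [← Finset.sum_fiberwise univ w]
  refine Finset.sum_congr rfl fun a _ => ?_
  rw [Finset.sum_congr rfl (g := fun _ => f a)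
    (fun i hi => by rw [(Finset.mem_filter.1 hi).2]), Finset.sum_const, nsmul_eq_mul, cnt]

theorem sum_cnt [Fintype A] (w : ι → A) : ∑ a, cnt w a = Fintype.card ι := by
  have := sum_comp_eq_sum_cnt w (fun _ => 1)
  simp only [sum_const, card_univ, nsmul_eq_mul, mul_one] at this
  exact_mod_cast this.symm

theorem sum_cnt_pair_right [Fintype B] (w : ι → A) (y : ι → B) (a : A) :
    ∑ b, cnt (fun i => (w i, y i)) (a, b) = cnt w a := by
  classical
  rw [cnt, Finset.card_eq_sum_card_fiberwise (f := y) (t := univ) (by simp)]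
  refine Finset.sum_congr rfl fun b _ => ?_
  rw [cnt, Finset.filter_filter]
  congr 1
  ext i
  simp [Prod.ext_iff]

theorem sum_cnt_pair_left [Fintype A] (w : ι → A) (y : ι → B) (b : B) :
    ∑ a, cnt (fun i => (w i, y i)) (a, b) = cnt y b := by
  rw [← sum_cnt_pair_right y w b]
  refine Finset.sum_congr rfl fun a _ => ?_
  rw [cnt, cnt]
  congr 1
  ext i
  simp [Prod.ext_iff, and_comm]

/-- Two sequences of the same type are permutations of one another. -/
theorem exists_perm_of_cnt_eq {u v : ι → A} (h : cnt u = cnt v) :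
    ∃ g : Equiv.Perm ι, v ∘ g = u := by
  have e : ∀ a, Nonempty ({i // u i = a} ≃ {i // v i = a}) := fun a =>
    Finite.card_eq.1 (by rw [← cnt_eq_natCard, ← cnt_eq_natCard, h])
  exact ⟨Equiv.ofFiberEquiv fun a => (e a).some,
    funext fun i => Equiv.ofFiberEquiv_map _ i⟩

theorem cnt_comp_perm (u : ι → A) (g : Equiv.Perm ι) : cnt (u ∘ g) = cnt u := by
  funext a
  rw [cnt_eq_natCard, cnt_eq_natCard]
  exact Nat.card_congr (g.subtypeEquiv fun i => Iff.rfl)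

/-- Every joint type that is compatible with the type of `w` is realized by some `y`. -/
theorem exists_cnt_pair_eq [Fintype B] (w : ι → A) (J : A × B → ℕ)
    (hJ : ∀ a, ∑ b, J (a, b) = cnt w a) :
    ∃ y : ι → B, cnt (fun i => (w i, y i)) = J := by
  have e : ∀ a, Nonempty ({i // w i = a} ≃ Σ b, Fin (J (a, b))) := fun a => by
    rw [← Finite.card_eq, ← cnt_eq_natCard, ← hJ a]
    simp
  let e' := fun a => (e a).some
  refine ⟨fun i => (e' (w i) ⟨i, rfl⟩).1, ?_⟩
  funext ⟨a, b⟩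
  rw [cnt_eq_natCard]
  have e1 : {i // (w i, (e' (w i) ⟨i, rfl⟩).1) = (a, b)} ≃
      {s : Σ b, Fin (J (a, b)) // s.1 = b} := by
    refine Equiv.trans ?_ ((e' a).subtypeEquiv (p := fun i => (e' a i).1 = b) fun i => Iff.rfl)
    refine Equiv.trans (Equiv.subtypeEquivRight (q := fun i =>
      ∃ h : w i = a, (e' a ⟨i, h⟩).1 = b) fun i => ?_)
      (Equiv.subtypeSubtypeEquivSubtypeExists (fun i => w i = a)
        (fun i => (e' a i).1 = b)).symm
    rw [Prod.ext_iff]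
    constructor
    · rintro ⟨h1, h2⟩
      dsimp only at h1 h2
      subst h1
      exact ⟨rfl, h2⟩
    · rintro ⟨h1, h2⟩
      subst h1
      exact ⟨rfl, h2⟩
  rw [Nat.card_congr e1, Nat.card_congr (Equiv.sigmaSubtype b)]
  simp

/-- The size of a conditional type class. The permutations that fix `w` act transitively on it, and
the stabilizer of a sequence is a product of symmetric groups. -/
theorem card_condClass [Fintype A] [Fintype B] (w : ι → A) (J : A × B → ℕ)
    (hJ : ∀ a, ∑ b, J (a, b) = cnt w a) :
    Nat.card {y : ι → B // cnt (fun i => (w i, y i)) = J} * ∏ s, (J s).factorial =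
      ∏ a, (cnt w a).factorial := by
  obtain ⟨y₀, hy₀⟩ := exists_cnt_pair_eq w J hJ
  let S := {g : Equiv.Perm ι // w ∘ g = w}
  let T := {g : Equiv.Perm ι // (fun i => (w i, y₀ i)) ∘ g = fun i => (w i, y₀ i)}
  have hS : Nat.card S = ∏ a, (cnt w a).factorial := by
    simp only [cnt_eq_ncard]
    exact DomMulAct.stabilizer_ncard w
  have hT : Nat.card T = ∏ s, (J s).factorial := by
    rw [← hy₀]
    simp only [cnt_eq_ncard]
    exact DomMulAct.stabilizer_ncard (fun i => (w i, y₀ i))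
  have hpair : ∀ g : Equiv.Perm ι, w ∘ g = w →
      (fun i => (w i, (y₀ ∘ g) i)) = (fun i => (w i, y₀ i)) ∘ g := fun g hg => by
    funext i
    have := congrFun hg i
    simp only [Function.comp] at this ⊢
    rw [this]
  let f : S → {y : ι → B // cnt (fun i => (w i, y i)) = J} := fun g =>
    ⟨y₀ ∘ g.1, by rw [hpair g.1 g.2, cnt_comp_perm, hy₀]⟩
  have hf : ∀ y, Nat.card {g // f g = y} = Nat.card T := by
    rintro ⟨y, hy⟩
    obtain ⟨g₀, hg₀⟩ := exists_perm_of_cnt_eq (hy.trans hy₀.symm)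
    have h1 : ∀ i, w (g₀ i) = w i := fun i => congrArg Prod.fst (congrFun hg₀ i)
    have h2 : ∀ i, y₀ (g₀ i) = y i := fun i => congrArg Prod.snd (congrFun hg₀ i)
    refine Nat.card_congr ⟨fun g => ⟨g₀⁻¹.trans g.1.1, ?_⟩,
      fun t => ⟨⟨g₀.trans t.1, ?_⟩, ?_⟩, fun g => ?_, fun t => ?_⟩
    · funext i
      have e1 := congrFun g.1.2 (g₀⁻¹ i)
      have e2 := congrFun (congrArg Subtype.val g.2) (g₀⁻¹ i)
      simp only [Function.comp, f, Equiv.trans_apply] at e1 e2 ⊢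
      rw [e1, e2, ← h1, ← h2]
      simp
    · funext i
      have := congrArg Prod.fst (congrFun t.2 (g₀ i))
      simp only [Function.comp, Equiv.trans_apply] at this ⊢
      rw [this, h1]
    · apply Subtype.ext
      funext i
      have := congrArg Prod.snd (congrFun t.2 (g₀ i))
      simp only [Function.comp, Equiv.trans_apply, f] at this ⊢
      rw [this, h2]
    · apply Subtype.ext
      apply Subtype.ext
      ext i
      simp
    · apply Subtype.ext
      ext i
      simp
  have : Fintype {y : ι → B // cnt (fun i => (w i, y i)) = J} := Fintype.ofFinite _
  rw [← hS, ← hT, ← Nat.card_congr (Equiv.sigmaFiberEquiv f), Nat.card_sigma,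
    Finset.sum_congr rfl (fun y _ => hf y), Finset.sum_const, smul_eq_mul,
    Finset.card_univ, Nat.card_eq_fintype_card]

/-- There are only polynomially many types. -/
theorem card_image_cnt_le [Fintype A] [DecidableEq (A → ℕ)] (s : Finset (ι → A)) :
    #(s.image cnt) ≤ (Fintype.card ι + 1) ^ Fintype.card A := by
  classical
  calc _ ≤ #(Fintype.piFinset fun _ : A => range (Fintype.card ι + 1)) := by
        refine card_le_card fun c hc => ?_
        obtain ⟨w, -, rfl⟩ := mem_image.1 hc
        exact Fintype.mem_piFinset.2 fun a => mem_range.2 (Nat.lt_succ_of_le (cnt_le w a))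
    _ = _ := by simp

end Types

/-! ### Factorials, greedy covers, merged lists and repeated guessing -/

/-- The logarithmic error term of Stirling's formula, in a crude form. It absorbs all polynomial
factors. -/
noncomputable def polyErr (n : ℕ) : ℝ := 2 * Real.log (n + 1) + 1

theorem one_le_polyErr (n : ℕ) : 1 ≤ polyErr n := by
  have : 0 ≤ Real.log ((n : ℝ) + 1) := Real.log_nonneg (by linarith [n.cast_nonneg (α := ℝ)])
  unfold polyErr; linarith

theorem polyErr_nonneg (n : ℕ) : 0 ≤ polyErr n := zero_le_one.trans (one_le_polyErr n)

theorem polyErr_mono : Monotone polyErr := fun a b h => by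
  have : (a : ℝ) ≤ b := by exact_mod_cast h
  unfold polyErr
  gcongr

theorem log_le_polyErr (n : ℕ) : Real.log (n + 1) ≤ polyErr n := by
  have : 0 ≤ Real.log ((n : ℝ) + 1) := Real.log_nonneg (by linarith [n.cast_nonneg (α := ℝ)])
  unfold polyErr; linarith

theorem add_one_le_exp_polyErr (n : ℕ) : (n : ℝ) + 1 ≤ Real.exp (polyErr n) := by
  rw [← Real.log_le_iff_le_exp (by positivity)]
  exact log_le_polyErr n

theorem eventually_polyErr_le (C ε : ℝ) (hε : 0 < ε) :
    ∀ᶠ n : ℕ in Filter.atTop, C * polyErr n ≤ ε * n := by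
  have h1 : (fun n : ℕ => C * polyErr n) =o[Filter.atTop] fun n : ℕ => ((n : ℝ) + 1) := by
    have ht : Filter.Tendsto (fun n : ℕ => (n : ℝ) + 1) Filter.atTop Filter.atTop :=
      Filter.tendsto_atTop_add_const_right _ _ tendsto_natCast_atTop_atTop
    have h2 := Real.isLittleO_log_id_atTop.comp_tendsto ht
    have h3 : (fun _ : ℕ => (1 : ℝ)) =o[Filter.atTop] fun n : ℕ => ((n : ℝ) + 1) := by
      rw [Asymptotics.isLittleO_one_left_iff]
      exact Filter.tendsto_abs_atTop_atTop.comp ht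
    exact (((h2.const_mul_left 2).add h3).const_mul_left C)
  have h4 := h1.bound (half_pos hε)
  filter_upwards [h4, Filter.eventually_ge_atTop 1] with n hn h1n
  have h1' : (1 : ℝ) ≤ n := by exact_mod_cast h1n
  rw [Real.norm_eq_abs, Real.norm_eq_abs, abs_of_nonneg (by linarith : (0 : ℝ) ≤ n + 1)] at hn
  have := le_abs_self (C * polyErr n)
  nlinarith

theorem mul_log_sub_le_log_factorial (k : ℕ) :
    (k : ℝ) * Real.log k - k ≤ Real.log k.factorial := by
  rcases Nat.eq_zero_or_pos k with rfl | hk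
  · simp
  have hk' : (0 : ℝ) < k := by exact_mod_cast hk
  have hf : (0 : ℝ) < k.factorial := by exact_mod_cast k.factorial_pos
  have h := Real.log_le_log (by positivity) (Real.pow_div_factorial_le_exp _ hk'.le k)
  rw [Real.log_exp, Real.log_div (by positivity) hf.ne', Real.log_pow] at h
  linarith

theorem log_factorial_le (k : ℕ) :
    Real.log k.factorial ≤ (k : ℝ) * Real.log k - k + polyErr k := by
  unfold polyErr
  induction k with
  | zero => simp
  | succ k ih =>
    have hk : (0 : ℝ) ≤ k := k.cast_nonneg
    rw [Nat.factorial_succ, Nat.cast_mul, Real.log_mul (by positivity) (by positivity)]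
    push_cast
    -- `log (1 + 1 / m) ≥ 1 / (m + 1)`, used for `m = k` and `m = k + 1`
    have h1 : (k : ℝ) * Real.log k + k / (k + 1) ≤ k * Real.log (k + 1) := by
      rcases hk.eq_or_lt with h0 | h0
      · simp [← h0]
      have := Real.one_sub_inv_le_log_of_pos (x := (k + 1) / k) (by positivity)
      rw [Real.log_div (by positivity) h0.ne', inv_div] at this
      have h2 : 1 - (k : ℝ) / (k + 1) = 1 / (k + 1) := by field_simp; ring
      have h3 := mul_le_mul_of_nonneg_left this hk
      rw [h2] at h3
      rw [mul_one_div] at h3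
      linarith
    have h2 : Real.log (k + 1) + 1 / (k + 2) ≤ Real.log (k + 1 + 1) := by
      have := Real.one_sub_inv_le_log_of_pos (x := ((k : ℝ) + 1 + 1) / (k + 1)) (by positivity)
      rw [Real.log_div (by positivity) (by positivity), inv_div] at this
      have h2 : 1 - ((k : ℝ) + 1) / (k + 1 + 1) = 1 / (k + 2) := by
        rw [show (k : ℝ) + 1 + 1 = k + 2 by ring]; field_simp; ring
      linarith
    have h3 : 1 ≤ (k : ℝ) / (k + 1) + 2 * (1 / (k + 2)) := by
      have : (k : ℝ) / (k + 1) + 2 * (1 / (k + 2)) - 1 = k / ((k + 1) * (k + 2)) := by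
        field_simp; ring
      have h4 : 0 ≤ (k : ℝ) / ((k + 1) * (k + 2)) := by positivity
      linarith
    linarith

/-- The linear terms of Stirling's formula add up to the length `n`, so they cancel between counts
of sequences of the same length. -/
theorem abs_sum_log_factorial_sub_le {A : Type*} [Fintype A] (c : A → ℕ) (n : ℕ)
    (hc : ∑ a, c a = n) :
    |∑ a, Real.log (c a).factorial - (∑ a, (c a : ℝ) * Real.log (c a) - n)| ≤
      Fintype.card A * polyErr n := by
  have hle : ∀ a, c a ≤ n := fun a => hc ▸ single_le_sum (fun _ _ => Nat.zero_le _) (mem_univ a)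
  have hn : (n : ℝ) = ∑ a, (c a : ℝ) := by rw [← hc]; push_cast; rfl
  rw [hn, ← sum_sub_distrib, ← sum_sub_distrib]
  refine (abs_sum_le_sum_abs _ _).trans ?_
  rw [← nsmul_eq_mul, ← card_univ]
  refine sum_le_card_nsmul _ _ _ fun a _ => ?_
  rw [abs_le]
  constructor
  · linarith [mul_log_sub_le_log_factorial (c a), polyErr_nonneg n]
  · linarith [log_factorial_le (c a), polyErr_mono (hle a)]

open Classical in
/-- Greedy covering: if every `x ∈ A` is related to at least `N` of the elements of `B`, then
some element of `B` covers a fraction `N / #B` of what is left, and iterating this about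
`(#B / N) log #A` times leaves nothing uncovered. -/
theorem exists_cover {α β : Type*} (A : Finset α) (B : Finset β) (r : α → β → Prop) (N : ℝ)
    (hN : 0 < N) (h : ∀ x ∈ A, N ≤ #{y ∈ B | r x y}) :
    ∃ C : Finset β, (#C : ℝ) ≤ #B / N * Real.log #A + 1 ∧ ∀ x ∈ A, ∃ y ∈ C, r x y := by
  rcases A.eq_empty_or_nonempty with rfl | hA
  · exact ⟨∅, by simp, by simp⟩
  obtain ⟨x₀, hx₀⟩ := hA
  have hAc : (0 : ℝ) < #A := by exact_mod_cast card_pos.2 ⟨x₀, hx₀⟩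
  have hNB : N ≤ #B := (h x₀ hx₀).trans (by exact_mod_cast card_filter_le _ _)
  have hB : (0 : ℝ) < #B := hN.trans_le hNB
  have hBne : B.Nonempty := card_pos.1 (by exact_mod_cast hB)
  set δ : ℝ := N / #B with hδ
  have hδ0 : 0 < δ := div_pos hN hB
  have hδ1 : δ ≤ 1 := (div_le_one hB).2 hNB
  have key : ∀ M : ℕ, ∃ C : Finset β, #C ≤ M ∧
      (#{x ∈ A | ∀ y ∈ C, ¬ r x y} : ℝ) ≤ (1 - δ) ^ M * #A := by
    intro M
    induction M with
    | zero => exact ⟨∅, by simp, by simp⟩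
    | succ M ih =>
      obtain ⟨C, hC, hU⟩ := ih
      set U := {x ∈ A | ∀ y ∈ C, ¬ r x y} with hUdef
      have hsum : ∑ _y ∈ B, δ * #U ≤ ∑ y ∈ B, (#{x ∈ U | r x y} : ℝ) := by
        have e := sum_card_bipartiteAbove_eq_sum_card_bipartiteBelow (s := U) (t := B) r
        have e' : ∑ y ∈ B, (#{x ∈ U | r x y} : ℝ) = ∑ x ∈ U, (#{y ∈ B | r x y} : ℝ) := by
          exact_mod_cast e.symm
        rw [e', sum_const, nsmul_eq_mul]
        have : ∑ _x ∈ U, N ≤ ∑ x ∈ U, (#{y ∈ B | r x y} : ℝ) :=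
          sum_le_sum fun x hx => h x (mem_filter.1 hx).1
        rw [sum_const, nsmul_eq_mul] at this
        have e2 : (#B : ℝ) * (δ * #U) = #U * N := by rw [hδ]; field_simp
        linarith
      obtain ⟨y, -, hy⟩ := exists_le_of_sum_le hBne hsum
      refine ⟨insert y C, (card_insert_le _ _).trans (by lia), ?_⟩
      have hsplit := card_filter_add_card_filter_not (s := U) (fun x => r x y)
      have heq : {x ∈ A | ∀ y' ∈ insert y C, ¬ r x y'} = {x ∈ U | ¬ r x y} := by
        ext x
        simp only [hUdef, mem_filter, mem_insert, forall_eq_or_imp]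
        tauto
      rw [heq]
      have hs : (#{x ∈ U | r x y} : ℝ) + #{x ∈ U | ¬ r x y} = #U := by exact_mod_cast hsplit
      calc (#{x ∈ U | ¬ r x y} : ℝ) ≤ (1 - δ) * #U := by linarith
        _ ≤ (1 - δ) * ((1 - δ) ^ M * #A) := by
            apply mul_le_mul_of_nonneg_left hU; linarith
        _ = _ := by ring
  set M := ⌊Real.log #A / δ⌋₊ + 1 with hM
  obtain ⟨C, hC, hU⟩ := key M
  have hlog : 0 ≤ Real.log #A := Real.log_natCast_nonneg _
  refine ⟨C, ?_, ?_⟩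
  · calc (#C : ℝ) ≤ M := by exact_mod_cast hC
      _ ≤ Real.log #A / δ + 1 := by
        rw [hM]; push_cast
        have := Nat.floor_le (div_nonneg hlog hδ0.le)
        linarith
      _ = _ := by rw [hδ]; field_simp
  · have hlt : (1 - δ) ^ M * #A < 1 := by
      have h1 : (1 - δ) ^ M ≤ Real.exp (-δ * M) := by
        rw [mul_comm, Real.exp_nat_mul]
        exact pow_le_pow_left₀ (by linarith) (by linarith [Real.add_one_le_exp (-δ)]) _
      have h2 : Real.log #A / δ < M := by rw [hM]; push_cast; exact Nat.lt_floor_add_one _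
      rw [div_lt_iff₀ hδ0] at h2
      have h3 : Real.exp (-δ * M) < (#A : ℝ)⁻¹ := by
        rw [← Real.exp_log (inv_pos.2 hAc), Real.log_inv]
        exact Real.exp_lt_exp.2 (by linarith)
      calc (1 - δ) ^ M * #A ≤ Real.exp (-δ * M) * #A := by gcongr
        _ < (#A : ℝ)⁻¹ * #A := by gcongr
        _ = 1 := inv_mul_cancel₀ hAc.ne'
    have h0 : #{x ∈ A | ∀ y ∈ C, ¬ r x y} = 0 := by
      have := hU.trans_lt hlt
      have : #{x ∈ A | ∀ y ∈ C, ¬ r x y} < 1 := by exact_mod_cast this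
      lia
    intro x hx
    by_contra hcon
    push Not at hcon
    have : x ∈ ({x ∈ A | ∀ y ∈ C, ¬ r x y} : Finset α) := mem_filter.2 ⟨hx, hcon⟩
    rw [card_eq_zero.1 h0] at this
    simp at this

/-- Listing several sets by increasing size puts each element of a set `C i` at a position at most
the number of sets times the size of `C i`. -/
theorem exists_nodup_list {I β : Type*} (s : Finset I) (C : I → Finset β) :
    ∃ l : List β, l.Nodup ∧ l.length ≤ ∑ i ∈ s, #(C i) ∧
      ∀ i ∈ s, ∀ b ∈ C i, ∃ j : Fin l.length, l.get j = b ∧ (j : ℕ) + 1 ≤ #s * #(C i) := by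
  classical
  induction s using Finset.induction_on_max_value (fun i => #(C i)) with
  | empty => exact ⟨[], by simp, by simp, by simp⟩
  | insert a s ha hmax ih =>
    obtain ⟨l, hnd, hlen, hl⟩ := ih
    set m := (C a \ l.toFinset).toList with hm
    have hlen' : (l ++ m).length ≤ ∑ i ∈ insert a s, #(C i) := by
      rw [sum_insert ha, List.length_append, hm, length_toList]
      have := card_le_card (sdiff_subset (s := C a) (t := l.toFinset))
      lia
    have hcard : ∑ i ∈ insert a s, #(C i) ≤ #(insert a s) * #(C a) := by
      rw [← smul_eq_mul]
      refine sum_le_card_nsmul _ _ _ fun i hi => ?_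
      rcases mem_insert.1 hi with rfl | hi
      · exact le_rfl
      · exact hmax i hi
    refine ⟨l ++ m, ?_, hlen', ?_⟩
    · refine List.nodup_append'.2 ⟨hnd, nodup_toList _, ?_⟩
      intro b hb hb'
      rw [hm, mem_toList, mem_sdiff, List.mem_toFinset] at hb'
      exact hb'.2 hb
    · intro i hi b hb
      rcases mem_insert.1 hi with rfl | hi
      · have hbm : b ∈ l ++ m := by
          rw [List.mem_append, hm, mem_toList, mem_sdiff, List.mem_toFinset]
          tauto
        obtain ⟨j, hj⟩ := List.get_of_mem hbm
        exact ⟨j, hj, (Nat.succ_le_of_lt j.2).trans (hlen'.trans hcard)⟩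
      · obtain ⟨j, hj, hj'⟩ := hl i hi b hb
        refine ⟨⟨j, by rw [List.length_append]; lia⟩, ?_, hj'.trans ?_⟩
        · rw [← hj]
          simp [List.getElem_append_left]
        · exact Nat.mul_le_mul_right _ (card_le_card (subset_insert _ _))

open Classical in
/-- If no guess covers more than `L` elements of `A`, then the first `#A / (2 L)` guesses
miss at least half of `A`, so the counting function is on average at least `#A / (4 L)`. -/
theorem le_sum_count {X Y : Type*} (d : X → Y → ℝ) (D : ℝ) {n : ℕ} (S : GuessList Y n)
    (A : Finset (Fin n → X)) (L : ℝ) (hL : 0 < L)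
    (h : ∀ y, (#{x ∈ A | meanDist d x y ≤ D} : ℝ) ≤ L) :
    ENNReal.ofReal (#A * (#A / (4 * L))) ≤ ∑ x ∈ A, count d D S x := by
  set t : ℝ := #A / (2 * L) with ht
  have ht0 : 0 ≤ t := by positivity
  set J : Finset (Fin S.1.length) := {j | (j : ℝ) + 1 ≤ t} with hJ
  set E := J.biUnion fun j => {x ∈ A | meanDist d x (S.1.get j) ≤ D} with hE
  have hJc : (#J : ℝ) ≤ t := by
    have : #J ≤ #(range ⌊t⌋₊) := by
      refine card_le_card_of_injOn (fun j => (j : ℕ)) (fun j hj => ?_)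
        (fun a _ b _ hab => Fin.ext hab)
      have hj' : (j : ℝ) + 1 ≤ t := (mem_filter.1 hj).2
      rw [mem_coe, mem_range, ← Nat.succ_le_iff, Nat.le_floor_iff ht0]
      push_cast
      exact hj'
    rw [card_range] at this
    exact (Nat.cast_le.2 this).trans (Nat.floor_le ht0)
  have hEc : (#E : ℝ) ≤ #A / 2 := by
    calc (#E : ℝ) ≤ ∑ j ∈ J, (#{x ∈ A | meanDist d x (S.1.get j) ≤ D} : ℝ) := by
          exact_mod_cast card_biUnion_le
      _ ≤ #J * L := by
          rw [← nsmul_eq_mul]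
          exact sum_le_card_nsmul _ _ _ fun j _ => h _
      _ ≤ t * L := by gcongr
      _ = #A / 2 := by rw [ht]; field_simp
  have hEA : E ⊆ A := biUnion_subset.2 fun j _ => filter_subset _ _
  have hcount : ∀ x ∈ A \ E, ENNReal.ofReal t ≤ count d D S x := by
    intro x hx
    rw [mem_sdiff] at hx
    refine le_iInf₂ fun j hj => ?_
    by_contra hlt
    push Not at hlt
    refine hx.2 (mem_biUnion.2 ⟨j, ?_, mem_filter.2 ⟨hx.1, hj⟩⟩)
    refine mem_filter.2 ⟨mem_univ _, ?_⟩
    have h1 : ((j : ℕ) : ℝ≥0∞) + 1 = ENNReal.ofReal ((j : ℕ) + 1) := by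
      rw [ENNReal.ofReal_add (by positivity) zero_le_one]; simp
    rw [h1] at hlt
    exact (ENNReal.ofReal_lt_ofReal_iff_of_nonneg (by positivity)).1 hlt |>.le
  calc ENNReal.ofReal (#A * (#A / (4 * L)))
      ≤ ENNReal.ofReal (#(A \ E) * t) := by
        apply ENNReal.ofReal_le_ofReal
        have : (#(A \ E) : ℝ) = #A - #E := by
          rw [card_sdiff_of_subset hEA, Nat.cast_sub (card_le_card hEA)]
        rw [this]
        have e : (#A : ℝ) * (#A / (4 * L)) = #A / 2 * t := by rw [ht]; field_simp; ring
        rw [e]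
        exact mul_le_mul_of_nonneg_right (by linarith) ht0
    _ = ∑ _x ∈ A \ E, ENNReal.ofReal t := by
        rw [sum_const, nsmul_eq_mul, ENNReal.ofReal_mul (by positivity), ENNReal.ofReal_natCast]
    _ ≤ ∑ x ∈ A \ E, count d D S x := sum_le_sum hcount
    _ ≤ ∑ x ∈ A, count d D S x := sum_le_sum_of_subset sdiff_subset

/-! ### Conditional mutual information and the rate-distortion function on couplings -/

section Completion

variable {X Y Z : Type*} [Fintype Y] {q : X × Z → ℝ}

open Classical in
/-- Replace a joint mass function by one with `(X, Z)`-marginal `q`, by sending the missing mass at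
`(x, z)` to a letter `y₀ x` that reproduces `x` without distortion. -/
noncomputable def complete (y₀ : X → Y) (q : X × Z → ℝ) (s : X → Z → Y → ℝ) (x : X) (z : Z)
    (y : Y) : ℝ :=
  s x z y + if y = y₀ x then q (x, z) - ∑ y', s x z y' else 0

theorem sum_complete (y₀ : X → Y) (s : X → Z → Y → ℝ) (x : X) (z : Z) :
    ∑ y, complete y₀ q s x z y = q (x, z) := by
  classical
  simp [complete, sum_add_distrib]

theorem abs_complete_sub_le {y₀ : X → Y} {p s : X → Z → Y → ℝ} {η η' : ℝ} (x : X) (z : Z) (y : Y)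
    (h1 : |s x z y - p x z y| ≤ η) (h2 : |q (x, z) - ∑ y', s x z y'| ≤ η') :
    |complete y₀ q s x z y - p x z y| ≤ η + η' := by
  have hη' := (abs_nonneg _).trans h2
  unfold complete
  rw [add_sub_right_comm]
  refine (abs_add_le _ _).trans (add_le_add h1 ?_)
  split_ifs
  · exact h2
  · simpa using hη'

end Completion

section Information

variable {X Y Z : Type*} [Fintype X] [Fintype Y] [Fintype Z]

/-- Conditional mutual information as a combination of entropies, each of which is a sum of terms
`t * log t`. In this form it is continuous everywhere, the boundary of the simplex included. -/
noncomputable def infoFn (p : X → Z → Y → ℝ) : ℝ :=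
  (∑ x, ∑ z, ∑ y, p x z y * Real.log (p x z y)) +
    (∑ z, (∑ x, ∑ y, p x z y) * Real.log (∑ x, ∑ y, p x z y)) -
    (∑ x, ∑ z, (∑ y, p x z y) * Real.log (∑ y, p x z y)) -
    ∑ z, ∑ y, (∑ x, p x z y) * Real.log (∑ x, p x z y)

/-- The conventions `log 0 = 0` and `0 * log 0 = 0` make the two forms agree on the boundary. -/
theorem condMutualInfo_eq_infoFn (p : X → Z → Y → ℝ) (hp : ∀ x z y, 0 ≤ p x z y) :
    condMutualInfo p = infoFn p := by
  have hterm : ∀ x z y, p x z y *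
      Real.log ((p x z y * ∑ x', ∑ y', p x' z y') / ((∑ y', p x z y') * ∑ x', p x' z y)) =
      p x z y * Real.log (p x z y) + p x z y * Real.log (∑ x', ∑ y', p x' z y') -
        p x z y * Real.log (∑ y', p x z y') - p x z y * Real.log (∑ x', p x' z y) := by
    intro x z y
    rcases (hp x z y).eq_or_lt with h | h
    · simp [← h]
    have h1 : 0 < ∑ y', p x z y' :=
      h.trans_le (single_le_sum (f := fun y => p x z y) (fun y _ => hp x z y) (mem_univ y))
    have h2 : 0 < ∑ x', p x' z y :=
      h.trans_le (single_le_sum (f := fun x => p x z y) (fun x _ => hp x z y) (mem_univ x))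
    have h3 : 0 < ∑ x', ∑ y', p x' z y' :=
      h1.trans_le (single_le_sum (f := fun x => ∑ y', p x z y')
        (fun x _ => sum_nonneg fun y _ => hp x z y) (mem_univ x))
    rw [Real.log_div (by positivity) (by positivity), Real.log_mul h.ne' h3.ne',
      Real.log_mul h1.ne' h2.ne']
    ring
  unfold condMutualInfo infoFn
  simp only [hterm, sum_add_distrib, sum_sub_distrib]
  congr 2
  · congr 1
    rw [sum_comm]
    simp only [sum_mul]
  · simp only [sum_mul]
  · rw [sum_comm]
    refine sum_congr rfl fun z _ => ?_
    rw [sum_comm]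
    simp only [sum_mul]

theorem condMutualInfo_smul (c : ℝ) (hc : c ≠ 0) (p : X → Z → Y → ℝ) :
    condMutualInfo (fun x z y => c * p x z y) = c * condMutualInfo p := by
  unfold condMutualInfo
  simp only [mul_sum]
  refine sum_congr rfl fun x _ => sum_congr rfl fun z _ => sum_congr rfl fun y _ => ?_
  simp only [← mul_sum]
  rw [show c * p x z y * (c * ∑ x', ∑ y', p x' z y') =
      c * c * (p x z y * ∑ x', ∑ y', p x' z y') by ring,
    show c * (∑ y', p x z y') * (c * ∑ x', p x' z y) =
      c * c * ((∑ y', p x z y') * ∑ x', p x' z y) by ring,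
    mul_div_mul_left _ _ (mul_ne_zero hc hc), mul_assoc]

theorem infoFn_smul (c : ℝ) (hc : 0 < c) (p : X → Z → Y → ℝ) (hp : ∀ x z y, 0 ≤ p x z y) :
    infoFn (fun x z y => c * p x z y) = c * infoFn p := by
  rw [← condMutualInfo_eq_infoFn p hp, ← condMutualInfo_smul c hc.ne',
    condMutualInfo_eq_infoFn _ fun x z y => mul_nonneg hc.le (hp x z y)]

theorem continuous_infoFn : Continuous (infoFn : (X → Z → Y → ℝ) → ℝ) := by
  have h := Real.continuous_mul_log
  unfold infoFn
  refine ((Continuous.add ?_ ?_).sub ?_).sub ?_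
  · exact continuous_finsetSum _ fun x _ => continuous_finsetSum _ fun z _ =>
      continuous_finsetSum _ fun y _ => h.comp (by fun_prop)
  · exact continuous_finsetSum _ fun z _ =>
      h.comp (f := fun p : X → Z → Y → ℝ => ∑ x, ∑ y, p x z y) (by fun_prop)
  · exact continuous_finsetSum _ fun x _ => continuous_finsetSum _ fun z _ =>
      h.comp (f := fun p : X → Z → Y → ℝ => ∑ y, p x z y) (by fun_prop)
  · exact continuous_finsetSum _ fun z _ => continuous_finsetSum _ fun y _ =>
      h.comp (f := fun p : X → Z → Y → ℝ => ∑ x, p x z y) (by fun_prop)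

theorem exists_infoFn_modulus (ε : ℝ) (hε : 0 < ε) :
    ∃ δ > 0, ∀ p p' : X → Z → Y → ℝ, (∀ x z y, p x z y ∈ Set.Icc (0 : ℝ) 1) →
      (∀ x z y, p' x z y ∈ Set.Icc (0 : ℝ) 1) → (∀ x z y, |p x z y - p' x z y| < δ) →
      |infoFn p - infoFn p'| < ε := by
  have hK : IsCompact (Set.Icc (0 : X → Z → Y → ℝ) 1) := isCompact_Icc
  have hu := hK.uniformContinuousOn_of_continuous continuous_infoFn.continuousOn
  obtain ⟨δ, hδ, h⟩ := Metric.uniformContinuousOn_iff.1 hu ε hε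
  refine ⟨δ, hδ, fun p p' hp hp' hd => h p ?_ p' ?_ ?_⟩
  · exact ⟨fun x z y => (hp x z y).1, fun x z y => (hp x z y).2⟩
  · exact ⟨fun x z y => (hp' x z y).1, fun x z y => (hp' x z y).2⟩
  · exact (dist_pi_lt_iff hδ).2 fun x => (dist_pi_lt_iff hδ).2 fun z =>
      (dist_pi_lt_iff hδ).2 fun y => hd x z y

/-- The joint mass functions of `(X, Z, Y)` for which `(X, Z)` has mass function `q` and
`E[d(X, Y)] ≤ D`. These stand for the conditional laws `W` in the definition of the
rate-distortion function, without the ambiguity of `W` where `q` vanishes. -/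
def couplings (d : X → Y → ℝ) (D : ℝ) (q : X × Z → ℝ) : Set (X → Z → Y → ℝ) :=
  {p | (∀ x z y, 0 ≤ p x z y) ∧ (∀ x z, ∑ y, p x z y = q (x, z)) ∧ expectedDist d p ≤ D}

variable {d : X → Y → ℝ} {D : ℝ} {q : X × Z → ℝ}

theorem le_of_mem_couplings {p : X → Z → Y → ℝ} (hp : p ∈ couplings d D q) (x : X) (z : Z) (y : Y) :
    p x z y ≤ q (x, z) :=
  hp.2.1 x z ▸ single_le_sum (f := fun y => p x z y) (fun y _ => hp.1 x z y) (mem_univ y)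

theorem continuous_expectedDist (d : X → Y → ℝ) :
    Continuous (expectedDist d : (X → Z → Y → ℝ) → ℝ) := by
  unfold expectedDist; fun_prop

theorem isCompact_couplings : IsCompact (couplings d D q) := by
  have hK : IsCompact (Set.Icc (0 : X → Z → Y → ℝ) fun x z _ => q (x, z)) := isCompact_Icc
  refine hK.of_isClosed_subset ?_ fun p hp =>
    ⟨fun x z y => hp.1 x z y, fun x z y => le_of_mem_couplings hp x z y⟩
  have h1 : IsClosed {p : X → Z → Y → ℝ | ∀ x z y, 0 ≤ p x z y} := by
    simp only [Set.ofPred_forall]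
    exact isClosed_iInter fun x => isClosed_iInter fun z => isClosed_iInter fun y =>
      isClosed_le continuous_const (by fun_prop)
  have h2 : IsClosed {p : X → Z → Y → ℝ | ∀ x z, ∑ y, p x z y = q (x, z)} := by
    simp only [Set.ofPred_forall]
    exact isClosed_iInter fun x => isClosed_iInter fun z =>
      isClosed_eq (by fun_prop) continuous_const
  exact h1.inter (h2.inter (isClosed_le (continuous_expectedDist d) continuous_const))

/-- Completion does not add distortion, so it turns any sub-mass of a feasible `p` into a feasible
coupling, whatever its marginal `q`. This holds for `D = 0` too. -/
theorem complete_mem_couplings (hd : ∀ x y, 0 ≤ d x y) {y₀ : X → Y} (hy₀ : ∀ x, d x (y₀ x) = 0)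
    {p s : X → Z → Y → ℝ} (hp : expectedDist d p ≤ D) (hs : ∀ x z y, 0 ≤ s x z y)
    (hsp : ∀ x z y, s x z y ≤ p x z y) (hsq : ∀ x z, ∑ y, s x z y ≤ q (x, z)) :
    complete y₀ q s ∈ couplings d D q := by
  refine ⟨fun x z y => ?_, fun x z => sum_complete y₀ s x z, le_trans ?_ hp⟩
  · unfold complete
    have := hs x z y
    have := hsq x z
    split_ifs <;> linarith
  · refine sum_le_sum fun x _ => sum_le_sum fun z _ => sum_le_sum fun y _ => ?_
    unfold complete
    split_ifs with h
    · rw [h, hy₀]; simp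
    · rw [add_zero]
      exact mul_le_mul_of_nonneg_right (hsp x z y) (hd x y)

/-- The conditional rate-distortion function of the mass function `q`, as a real number. -/
noncomputable def rate (d : X → Y → ℝ) (D : ℝ) (q : X × Z → ℝ) : ℝ :=
  sInf (infoFn '' couplings d D q)

theorem exists_rate_eq (hd : ∀ x y, 0 ≤ d x y) {y₀ : X → Y} (hy₀ : ∀ x, d x (y₀ x) = 0)
    (hD : 0 ≤ D) (hq : ∀ a, 0 ≤ q a) :
    ∃ p ∈ couplings d D q, infoFn p = rate d D q := by
  have hne : (couplings d D q).Nonempty :=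
    ⟨_, complete_mem_couplings (q := q) hd hy₀ (p := 0) (s := 0) (by simpa [expectedDist] using hD)
      (fun _ _ _ => le_rfl) (fun _ _ _ => le_rfl) (fun x z => by simpa using hq _)⟩
  exact (isCompact_couplings.image continuous_infoFn).sInf_mem (hne.image _)

theorem rate_le {p : X → Z → Y → ℝ} (hp : p ∈ couplings d D q) : rate d D q ≤ infoFn p :=
  csInf_le (isCompact_couplings.image continuous_infoFn).bddBelow (Set.mem_image_of_mem _ hp)

/-- Uniform continuity of the rate-distortion function in the law, at a fixed distortion `D`. -/
theorem exists_rate_modulus (hd : ∀ x y, 0 ≤ d x y) {y₀ : X → Y} (hy₀ : ∀ x, d x (y₀ x) = 0)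
    (hD : 0 ≤ D) (ε : ℝ) (hε : 0 < ε) :
    ∃ δ > 0, ∀ q q' : X × Z → ℝ, (∀ a, q a ∈ Set.Icc (0 : ℝ) 1) →
      (∀ a, q' a ∈ Set.Icc (0 : ℝ) 1) → (∀ a, |q a - q' a| < δ) →
      rate d D q' < rate d D q + ε := by
  obtain ⟨δ, hδ, h⟩ := exists_infoFn_modulus (X := X) (Y := Y) (Z := Z) ε hε
  refine ⟨δ / 2, half_pos hδ, fun q q' hq hq' hqq' => ?_⟩
  obtain ⟨p, hp, hpr⟩ := exists_rate_eq hd hy₀ hD (q := q) fun a => (hq a).1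
  -- scale `p` down to the marginal `min q q'`, then complete to `q'`
  let s : X → Z → Y → ℝ := fun x z y => p x z y * (min (q (x, z)) (q' (x, z)) / q (x, z))
  have hmin0 : ∀ a, 0 ≤ min (q a) (q' a) := fun a => le_min (hq a).1 (hq' a).1
  have hratio : ∀ a, min (q a) (q' a) / q a ≤ 1 := fun a =>
    div_le_one_of_le₀ (min_le_left _ _) (hq a).1
  have hsum : ∀ x z, ∑ y, s x z y = min (q (x, z)) (q' (x, z)) := fun x z => by
    simp only [s]
    rw [← sum_mul, hp.2.1]
    rcases (hq (x, z)).1.eq_or_lt with h0 | h0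
    · rw [← h0, min_eq_left (hq' _).1]; simp
    · field_simp
  have hdiff : ∀ a, q a - min (q a) (q' a) ≤ |q a - q' a| ∧
      q' a - min (q a) (q' a) ≤ |q a - q' a| := fun a => by
    rcases min_cases (q a) (q' a) with ⟨h1, -⟩ | ⟨h1, -⟩ <;> rw [h1]
    · exact ⟨by simp, by rw [abs_sub_comm]; exact le_abs_self _⟩
    · exact ⟨le_abs_self _, by simp⟩
  have hs0 : ∀ x z y, 0 ≤ s x z y := fun x z y =>
    mul_nonneg (hp.1 x z y) (div_nonneg (hmin0 _) (hq _).1)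
  have hsp : ∀ x z y, s x z y ≤ p x z y := fun x z y =>
    mul_le_of_le_one_right (hp.1 x z y) (hratio _)
  have hmem : complete y₀ q' s ∈ couplings d D q' :=
    complete_mem_couplings hd hy₀ hp.2.2 hs0 hsp
      (fun x z => (hsum x z).trans_le (min_le_right _ _))
  have hclose : ∀ x z y, |complete y₀ q' s x z y - p x z y| < δ := fun x z y => by
    have hlt := hqq' (x, z)
    refine (abs_complete_sub_le x z y (η := |q (x, z) - q' (x, z)|)
      (η' := |q (x, z) - q' (x, z)|) ?_ ?_).trans_lt (by linarith)
    · rw [abs_sub_comm, abs_of_nonneg (sub_nonneg.2 (hsp x z y))]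
      refine le_trans ?_ (hdiff (x, z)).1
      have hle := le_of_mem_couplings hp x z y
      have hr := hratio (x, z)
      have h1 : p x z y - s x z y =
          p x z y * (1 - min (q (x, z)) (q' (x, z)) / q (x, z)) := by simp only [s]; ring
      rw [h1]
      refine (mul_le_mul_of_nonneg_right hle (by linarith)).trans_eq ?_
      rcases (hq (x, z)).1.eq_or_lt with h0 | h0
      · rw [← h0, min_eq_left (hq' _).1]; simp
      · field_simp
    · rw [hsum, abs_of_nonneg (sub_nonneg.2 (min_le_right _ _))]
      exact (hdiff (x, z)).2
  have hI : ∀ {q : X × Z → ℝ} {p : X → Z → Y → ℝ}, (∀ a, q a ∈ Set.Icc (0 : ℝ) 1) →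
      p ∈ couplings d D q → ∀ x z y, p x z y ∈ Set.Icc (0 : ℝ) 1 := fun hq hp x z y =>
    ⟨hp.1 x z y, (le_of_mem_couplings hp x z y).trans (hq _).2⟩
  have := h _ _ (hI hq' hmem) (hI hq hp) hclose
  have h2 := rate_le hmem
  rw [abs_lt] at this
  linarith

theorem continuousOn_rate (hd : ∀ x y, 0 ≤ d x y) {y₀ : X → Y} (hy₀ : ∀ x, d x (y₀ x) = 0)
    (hD : 0 ≤ D) : ContinuousOn (rate d D : (X × Z → ℝ) → ℝ) (stdSimplex ℝ (X × Z)) := by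
  have hI : ∀ {q : X × Z → ℝ}, q ∈ stdSimplex ℝ (X × Z) → ∀ a, q a ∈ Set.Icc (0 : ℝ) 1 :=
    fun hq a => mem_Icc_of_mem_stdSimplex hq a
  rw [Metric.continuousOn_iff]
  intro q hq ε hε
  obtain ⟨δ, hδ, h⟩ := exists_rate_modulus (Z := Z) hd hy₀ hD ε hε
  refine ⟨δ, hδ, fun q' hq' hdist => ?_⟩
  have hdist' : ∀ a, |q' a - q a| < δ := (dist_pi_lt_iff hδ).1 hdist
  have h1 := h q' q (hI hq') (hI hq) hdist'
  have h2 := h q q' (hI hq) (hI hq') (fun a => by rw [abs_sub_comm]; exact hdist' a)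
  rw [Real.dist_eq, abs_lt]
  constructor <;> linarith

end Information

/-! ### Laws and relative entropy -/

/-- The mass function of a law, as a real-valued function. -/
def realMass {α : Type*} (Q : PMF α) (a : α) : ℝ := (Q a).toReal

theorem realMass_eq_zero_iff {α : Type*} (Q : PMF α) (a : α) : realMass Q a = 0 ↔ Q a = 0 := by
  rw [realMass, ENNReal.toReal_eq_zero_iff]
  simp [Q.apply_ne_top a]

section Laws

variable {α : Type*} [Fintype α]

theorem realMass_mem_stdSimplex (Q : PMF α) : realMass Q ∈ stdSimplex ℝ α := by
  refine ⟨fun a => ENNReal.toReal_nonneg, ?_⟩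
  have h := Q.tsum_coe
  rw [tsum_fintype] at h
  have := congrArg ENNReal.toReal h
  rwa [ENNReal.toReal_sum fun a _ => Q.apply_ne_top a, ENNReal.toReal_one] at this

theorem exists_realMass_eq {q : α → ℝ} (hq : q ∈ stdSimplex ℝ α) : ∃ Q : PMF α, realMass Q = q := by
  refine ⟨PMF.ofFintype (fun a => ENNReal.ofReal (q a)) ?_, ?_⟩
  · rw [← ENNReal.ofReal_sum_of_nonneg fun a _ => hq.1 a, hq.2, ENNReal.ofReal_one]
  · funext a
    rw [realMass, PMF.ofFintype_apply, ENNReal.toReal_ofReal (hq.1 a)]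

/-- The relative entropy of `q` with respect to `P`, as a function that is continuous in `q`. It is
the relative entropy only if `q` vanishes wherever `P` does, since `log 0 = 0` here. -/
noncomputable def klFn (P : PMF α) (q : α → ℝ) : ℝ :=
  ∑ a, (q a * Real.log (q a) - q a * Real.log (realMass P a))

theorem continuous_klFn (P : PMF α) : Continuous (klFn P) := by
  unfold klFn
  refine continuous_finsetSum _ fun a _ => ?_
  exact (Real.continuous_mul_log.comp (continuous_apply a)).sub
    ((continuous_apply a).mul continuous_const)

theorem relEntropy_eq_top {Q P : PMF α} (h : ¬ ∀ a, P a = 0 → Q a = 0) : relEntropy Q P = ⊤ := by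
  let _ : MeasurableSpace α := ⊤
  refine InformationTheory.klDiv_of_not_ac fun hac => h fun a ha => ?_
  have := @hac {a} (by
    rw [PMF.toMeasure_apply_singleton _ _ (MeasurableSet.singleton a), ha])
  rwa [PMF.toMeasure_apply_singleton _ _ (MeasurableSet.singleton a)] at this

theorem relEntropy_eq_klFn {Q P : PMF α} (h : ∀ a, P a = 0 → Q a = 0) :
    (relEntropy Q P : EReal) = (klFn P (realMass Q) : ℝ) := by
  let _ : MeasurableSpace α := ⊤
  have hQs : ∀ a, Q.toMeasure {a} = Q a := fun a =>
    PMF.toMeasure_apply_singleton _ _ (MeasurableSet.singleton a)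
  have hPs : ∀ a, P.toMeasure {a} = P a := fun a =>
    PMF.toMeasure_apply_singleton _ _ (MeasurableSet.singleton a)
  have hac : Q.toMeasure.AbsolutelyContinuous P.toMeasure := by
    intro s hs
    rw [PMF.toMeasure_apply_eq_zero_iff _ MeasurableSpace.measurableSet_top] at hs ⊢
    refine hs.mono_left fun a ha => ?_
    rw [PMF.mem_support_iff] at ha ⊢
    exact fun h0 => ha (h a h0)
  have hint : MeasureTheory.Integrable (MeasureTheory.llr Q.toMeasure P.toMeasure) Q.toMeasure :=
    MeasureTheory.Integrable.of_finite
  have hne : relEntropy Q P ≠ ⊤ := InformationTheory.klDiv_ne_top hac hint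
  have hreal : (relEntropy Q P).toReal = klFn P (realMass Q) := by
    refine (InformationTheory.toReal_klDiv_of_measure_eq hac (by simp)).trans ?_
    rw [MeasureTheory.integral_fintype hint, klFn]
    refine sum_congr rfl fun a _ => ?_
    rw [MeasureTheory.measureReal_def, hQs, smul_eq_mul, ← mul_sub]
    change realMass Q a * _ = _
    rcases eq_or_ne (realMass Q a) 0 with h0 | h0
    · rw [h0, zero_mul, zero_mul]
    have hP0 : realMass P a ≠ 0 := fun hP =>
      h0 ((realMass_eq_zero_iff Q a).2 (h a ((realMass_eq_zero_iff P a).1 hP)))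
    have hr : Q.toMeasure.rnDeriv P.toMeasure a * P a = Q a := by
      have := MeasureTheory.Measure.setLIntegral_rnDeriv hac {a}
      rwa [MeasureTheory.lintegral_singleton, hQs, hPs] at this
    have hr' : (Q.toMeasure.rnDeriv P.toMeasure a).toReal * realMass P a = realMass Q a := by
      rw [realMass, realMass, ← ENNReal.toReal_mul, hr]
    rw [MeasureTheory.llr, ← Real.log_div h0 hP0, ← hr', mul_div_cancel_right₀ _ hP0]
  rw [← hreal, ← EReal.coe_ennreal_toReal hne]

end Laws

theorem jointMass_nonneg {X Y Z : Type*} (Q : PMF (X × Z)) (W : X → Z → PMF Y) (x : X) (z : Z)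
    (y : Y) :
    0 ≤ jointMass Q W x z y := mul_nonneg ENNReal.toReal_nonneg ENNReal.toReal_nonneg

/-- Every coupling comes from a conditional law, which is arbitrary where the marginal vanishes. -/
theorem exists_jointMass_eq {X Y Z : Type*} [Fintype Y] {Q : PMF (X × Z)} {p : X → Z → Y → ℝ}
    (y₀ : X → Y)
    (hp : ∀ x z y, 0 ≤ p x z y) (hq : ∀ x z, ∑ y, p x z y = realMass Q (x, z)) :
    ∃ W : X → Z → PMF Y, jointMass Q W = p := by
  have : ∀ x z, ∃ w : PMF Y, ∀ y, realMass Q (x, z) * realMass w y = p x z y := by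
    intro x z
    rcases eq_or_ne (realMass Q (x, z)) 0 with h0 | h0
    · refine ⟨PMF.pure (y₀ x), fun y => ?_⟩
      rw [h0, zero_mul]
      have := hq x z
      rw [h0, sum_eq_zero_iff_of_nonneg fun y _ => hp x z y] at this
      exact (this y (mem_univ y)).symm
    · have hpos : 0 ≤ realMass Q (x, z) := ENNReal.toReal_nonneg
      obtain ⟨w, hw⟩ := exists_realMass_eq (q := fun y => p x z y / realMass Q (x, z))
        ⟨fun y => div_nonneg (hp x z y) hpos, by rw [← sum_div, hq, div_self h0]⟩
      refine ⟨w, fun y => ?_⟩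
      rw [hw]
      field_simp
  choose W hW using this
  exact ⟨W, by funext x z y; exact hW x z y⟩

section RateDistortion

variable {X Y Z : Type*} [Fintype X] [Fintype Y] [Fintype Z] {d : X → Y → ℝ} {D : ℝ}

/-- The feasible set, described by couplings instead of conditional laws. -/
theorem feasibleInfo_eq (y₀ : X → Y) (Q : PMF (X × Z)) :
    feasibleInfo d D Q = Real.toEReal '' (infoFn '' couplings d D (realMass Q)) := by
  ext r
  constructor
  · rintro ⟨W, hW, rfl⟩
    refine ⟨_, ⟨jointMass Q W, ⟨jointMass_nonneg Q W, fun x z => ?_, hW⟩, rfl⟩, ?_⟩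
    · simp only [jointMass]
      rw [← mul_sum]
      have : ∑ y, (W x z y).toReal = 1 := (realMass_mem_stdSimplex (W x z)).2
      rw [this, mul_one, realMass]
    · rw [condMutualInfo_eq_infoFn _ (jointMass_nonneg Q W)]
  · rintro ⟨_, ⟨p, hp, rfl⟩, rfl⟩
    obtain ⟨W, rfl⟩ := exists_jointMass_eq y₀ hp.1 hp.2.1
    exact ⟨W, hp.2.2, by rw [condMutualInfo_eq_infoFn _ (jointMass_nonneg Q W)]⟩

theorem isLeast_feasibleInfo (hd : ∀ x y, 0 ≤ d x y) {y₀ : X → Y} (hy₀ : ∀ x, d x (y₀ x) = 0)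
    (hD : 0 ≤ D) (Q : PMF (X × Z)) :
    IsLeast (feasibleInfo d D Q) (rate d D (realMass Q)) := by
  rw [feasibleInfo_eq y₀]
  obtain ⟨p, hp, hpr⟩ := exists_rate_eq (q := realMass Q) hd hy₀ hD
    (realMass_mem_stdSimplex Q).1
  refine ⟨⟨_, ⟨p, hp, rfl⟩, by rw [hpr]⟩, ?_⟩
  rintro _ ⟨_, ⟨p', hp', rfl⟩, rfl⟩
  exact EReal.coe_le_coe_iff.2 (rate_le hp')

theorem condRateDist_eq_rate (hd : ∀ x y, 0 ≤ d x y) {y₀ : X → Y} (hy₀ : ∀ x, d x (y₀ x) = 0)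
    (hD : 0 ≤ D) (Q : PMF (X × Z)) :
    condRateDist d D Q = (rate d D (realMass Q) : ℝ) :=
  (isLeast_feasibleInfo hd hy₀ hD Q).csInf_eq

/-- `R(D, q) - D(q ‖ P)` has a maximizer among the laws `q` that are absolutely continuous with
respect to `P`. -/
theorem exists_isMaxOn_rate_sub_klFn (hd : ∀ x y, 0 ≤ d x y) {y₀ : X → Y}
    (hy₀ : ∀ x, d x (y₀ x) = 0) (hD : 0 ≤ D) (P : PMF (X × Z)) :
    ∃ q ∈ {q ∈ stdSimplex ℝ (X × Z) | ∀ a, P a = 0 → q a = 0},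
      ∀ q' ∈ {q ∈ stdSimplex ℝ (X × Z) | ∀ a, P a = 0 → q a = 0},
        rate d D q' - klFn P q' ≤ rate d D q - klFn P q := by
  have hclosed : IsClosed {q : X × Z → ℝ | ∀ a, P a = 0 → q a = 0} := by
    simp only [Set.ofPred_forall]
    exact isClosed_iInter fun a => isClosed_iInter fun _ =>
      isClosed_eq (continuous_apply a) continuous_const
  have hK := (isCompact_stdSimplex ℝ (X × Z)).inter_right hclosed
  obtain ⟨q, hq, hmax⟩ := hK.exists_isMaxOn
    ⟨realMass P, realMass_mem_stdSimplex P, fun a ha => (realMass_eq_zero_iff P a).2 ha⟩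
    (((continuousOn_rate hd hy₀ hD).mono Set.inter_subset_left).sub
      (continuous_klFn P).continuousOn)
  exact ⟨q, hq, fun q' hq' => hmax hq'⟩

end RateDistortion

/-! ### Sizes of type classes -/

section TypeClasses

variable {ι A B : Type*} [Fintype ι] [Fintype A] [Fintype B]

open Classical in
/-- The conditional type class: all `y` that have joint type `J` with the given sequence `w`. -/
noncomputable def condClass (w : ι → A) (J : A × B → ℕ) : Finset (ι → B) :=
  {y | cnt (fun i => (w i, y i)) = J}

theorem mem_condClass {w : ι → A} {J : A × B → ℕ} {y : ι → B} :
    y ∈ condClass w J ↔ cnt (fun i => (w i, y i)) = J := by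
  classical
  simp [condClass]

theorem card_condClass_mul (w : ι → A) (J : A × B → ℕ) (hJ : ∀ a, ∑ b, J (a, b) = cnt w a) :
    #(condClass w J) * ∏ s, (J s).factorial = ∏ a, (cnt w a).factorial := by
  classical
  rw [← card_condClass w J hJ]
  congr 1
  rw [Nat.card_eq_fintype_card, Fintype.card_subtype, condClass]

theorem card_condClass_pos (w : ι → A) (J : A × B → ℕ) (hJ : ∀ a, ∑ b, J (a, b) = cnt w a) :
    0 < #(condClass w J) := by
  obtain ⟨y, hy⟩ := exists_cnt_pair_eq w J hJ
  exact card_pos.2 ⟨y, mem_condClass.2 hy⟩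

theorem log_card_condClass (w : ι → A) (J : A × B → ℕ) (hJ : ∀ a, ∑ b, J (a, b) = cnt w a) :
    Real.log #(condClass w J) =
      ∑ a, Real.log (cnt w a).factorial - ∑ s, Real.log (J s).factorial := by
  have h := congrArg (fun m : ℕ => Real.log m) (card_condClass_mul w J hJ)
  have h0 : ((#(condClass w J) : ℕ) : ℝ) ≠ 0 := by exact_mod_cast (card_condClass_pos w J hJ).ne'
  simp only [Nat.cast_mul, Nat.cast_prod] at h
  rw [Real.log_mul h0 (prod_ne_zero_iff.2 fun s _ => by exact_mod_cast (J s).factorial_ne_zero),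
    Real.log_prod (fun s _ => by exact_mod_cast (J s).factorial_ne_zero),
    Real.log_prod (fun s _ => by exact_mod_cast (cnt w s).factorial_ne_zero)] at h
  linarith

open Classical in
/-- All sequences of type `k`. -/
noncomputable def typeClass (ι : Type*) [Fintype ι] (k : A → ℕ) : Finset (ι → A) :=
  {w | cnt w = k}

theorem mem_typeClass {k : A → ℕ} {w : ι → A} : w ∈ typeClass ι k ↔ cnt w = k := by
  classical
  simp [typeClass]

theorem typeClass_eq_condClass (k : A → ℕ) :
    typeClass ι k = condClass (fun _ : ι => ()) fun s => k s.2 := by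
  ext w
  rw [mem_typeClass, mem_condClass]
  have : ∀ a, cnt (fun i => ((), w i)) ((), a) = cnt w a := fun a => by
    rw [cnt, cnt]
    congr 1
    ext i
    simp
  constructor
  · rintro rfl
    funext ⟨_, a⟩
    exact this a
  · intro h
    funext a
    rw [← this a, h]

theorem sum_eq_cnt_unit {k : A → ℕ} (hk : ∑ a, k a = Fintype.card ι) (u : Unit) :
    ∑ a, (fun s : Unit × A => k s.2) (u, a) = cnt (fun _ : ι => ()) u := by
  rw [hk, cnt]
  simp

theorem card_typeClass_pos {k : A → ℕ} (hk : ∑ a, k a = Fintype.card ι) :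
    0 < #(typeClass ι k) := by
  rw [typeClass_eq_condClass]
  exact card_condClass_pos _ _ (sum_eq_cnt_unit hk)

theorem log_card_typeClass {k : A → ℕ} (hk : ∑ a, k a = Fintype.card ι) :
    Real.log #(typeClass ι k) =
      Real.log (Fintype.card ι).factorial - ∑ a, Real.log (k a).factorial := by
  rw [typeClass_eq_condClass, log_card_condClass _ _ (sum_eq_cnt_unit hk)]
  simp [Fintype.sum_prod_type, cnt]

end TypeClasses

section JointCounts

variable {ι X Y Z : Type*} [Fintype ι]

theorem cnt_swap {A B : Type*} (u : ι → A) (v : ι → B) (a : A) (b : B) :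
    cnt (fun i => (v i, u i)) (b, a) = cnt (fun i => (u i, v i)) (a, b) := by
  rw [cnt, cnt]
  congr 1
  ext i
  simp [Prod.ext_iff, and_comm]

/-- The joint type of three sequences. -/
noncomputable def jointCnt (x : ι → X) (z : ι → Z) (y : ι → Y) (a : X) (c : Z) (b : Y) : ℕ :=
  cnt (fun i => ((x i, z i), y i)) ((a, c), b)

theorem jointCnt_eq (x : ι → X) (z : ι → Z) (y : ι → Y) (a : X) (c : Z) (b : Y) :
    cnt (fun i => ((z i, y i), x i)) ((c, b), a) = jointCnt x z y a c b := by
  rw [cnt, jointCnt, cnt]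
  congr 1
  ext i
  simp only [Prod.ext_iff, mem_filter, mem_univ, true_and]
  tauto

theorem sum_jointCnt_y [Fintype Y] (x : ι → X) (z : ι → Z) (y : ι → Y) (a : X) (c : Z) :
    ∑ b, jointCnt x z y a c b = cnt (fun i => (x i, z i)) (a, c) :=
  sum_cnt_pair_right (fun i => (x i, z i)) y (a, c)

theorem sum_jointCnt_x [Fintype X] (x : ι → X) (z : ι → Z) (y : ι → Y) (c : Z) (b : Y) :
    ∑ a, jointCnt x z y a c b = cnt (fun i => (z i, y i)) (c, b) := by
  simp only [← jointCnt_eq]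
  exact sum_cnt_pair_right (fun i => (z i, y i)) x (c, b)

theorem sum_jointCnt_perm [Fintype X] [Fintype Y] [Fintype Z] (x : ι → X) (z : ι → Z) (y : ι → Y)
    (f : ℕ → ℝ) :
    ∑ s, f (cnt (fun i => ((z i, y i), x i)) s) = ∑ s, f (cnt (fun i => ((x i, z i), y i)) s) := by
  refine Fintype.sum_equiv ⟨fun s => ((s.2, s.1.1), s.1.2), fun s => ((s.1.2, s.2), s.1.1),
    fun _ => rfl, fun _ => rfl⟩ _ _ ?_
  rintro ⟨⟨c, b⟩, a⟩
  rw [jointCnt_eq]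
  rfl

end JointCounts

section Triples

variable {ι X Y Z : Type*} [Fintype ι] [Fintype X] [Fintype Y] [Fintype Z]

open Classical in
/-- All `x` such that `(x, z)` has joint type `k`. -/
noncomputable def sideClass (z : ι → Z) (k : X × Z → ℕ) : Finset (ι → X) :=
  {x | cnt (fun i => (x i, z i)) = k}

theorem mem_sideClass {z : ι → Z} {k : X × Z → ℕ} {x : ι → X} :
    x ∈ sideClass z k ↔ cnt (fun i => (x i, z i)) = k := by
  classical
  simp [sideClass]

theorem sideClass_eq_condClass (z : ι → Z) (k : X × Z → ℕ) :
    sideClass z k = condClass z fun s => k (s.2, s.1) := by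
  ext x
  rw [mem_sideClass, mem_condClass]
  constructor
  · rintro rfl
    funext ⟨c, a⟩
    exact cnt_swap _ _ _ _
  · intro h
    funext ⟨a, c⟩
    rw [← cnt_swap, h]

theorem log_card_sideClass (x : ι → X) (z : ι → Z) :
    Real.log #(sideClass z (cnt fun i => (x i, z i))) =
      ∑ c, Real.log (cnt z c).factorial -
        ∑ a, Real.log (cnt (fun i => (x i, z i)) a).factorial := by
  rw [sideClass_eq_condClass, log_card_condClass _ _ fun c => sum_cnt_pair_left x z c,
    Fintype.sum_prod_type, Fintype.sum_prod_type, sum_comm (γ := X)]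

/-- The multiple of `polyErr` by which the logarithm of a ratio of type-class sizes may differ from
a conditional mutual information. -/
noncomputable def infoErr (X Y Z : Type*) [Fintype X] [Fintype Y] [Fintype Z] : ℝ :=
  Fintype.card Z + Fintype.card ((X × Z) × Y) + Fintype.card (X × Z) + Fintype.card (Z × Y)

/-- The combination of factorials that governs both the covering of a conditional type class
and the part of it that a single guess covers is, up to polynomial factors, the exponential of
the empirical conditional mutual information. -/
theorem abs_log_factorials_sub_infoFn_le (x : ι → X) (z : ι → Z) (y : ι → Y) :
    |∑ c, Real.log (cnt z c).factorial +
          ∑ s, Real.log (cnt (fun i => ((x i, z i), y i)) s).factorial -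
          ∑ a, Real.log (cnt (fun i => (x i, z i)) a).factorial -
          ∑ s, Real.log (cnt (fun i => (z i, y i)) s).factorial -
        infoFn fun a c b => (jointCnt x z y a c b : ℝ)| ≤
      infoErr X Y Z * polyErr (Fintype.card ι) := by
  have h1 := abs_sum_log_factorial_sub_le (cnt z) _ (sum_cnt z)
  have h2 := abs_sum_log_factorial_sub_le (cnt fun i => ((x i, z i), y i)) _ (sum_cnt _)
  have h3 := abs_sum_log_factorial_sub_le (cnt fun i => (x i, z i)) _ (sum_cnt _)
  have h4 := abs_sum_log_factorial_sub_le (cnt fun i => (z i, y i)) _ (sum_cnt _)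
  have hinfo : infoFn (fun a c b => (jointCnt x z y a c b : ℝ)) =
      ∑ s, (cnt (fun i => ((x i, z i), y i)) s : ℝ) *
          Real.log (cnt (fun i => ((x i, z i), y i)) s) +
        ∑ c, (cnt z c : ℝ) * Real.log (cnt z c) -
        ∑ a, (cnt (fun i => (x i, z i)) a : ℝ) * Real.log (cnt (fun i => (x i, z i)) a) -
        ∑ s, (cnt (fun i => (z i, y i)) s : ℝ) * Real.log (cnt (fun i => (z i, y i)) s) := by
    unfold infoFn
    simp only [← Nat.cast_sum, sum_jointCnt_y, sum_jointCnt_x]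
    simp only [sum_cnt_pair_left]
    simp only [Fintype.sum_prod_type, jointCnt]
  rw [hinfo, infoErr]
  rw [abs_le] at h1 h2 h3 h4 ⊢
  constructor <;> nlinarith

end Triples

section Empirical

variable {X Y Z : Type*} [Fintype X] [Fintype Y] [Fintype Z] {n : ℕ}

/-- The empirical distribution that belongs to the counts `k` of a sequence of length `n`. -/
noncomputable def empirical {A : Type*} (n : ℕ) (k : A → ℕ) (a : A) : ℝ := 1 / n * k a

theorem empirical_mem_stdSimplex {A : Type*} [Fintype A] (hn : 0 < n) {k : A → ℕ}
    (hk : ∑ a, k a = n) : empirical n k ∈ stdSimplex ℝ A := by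
  refine ⟨fun a => by unfold empirical; positivity, ?_⟩
  have hn' : (n : ℝ) ≠ 0 := by exact_mod_cast hn.ne'
  simp only [empirical]
  rw [← mul_sum, ← Nat.cast_sum, hk, one_div_mul_cancel hn']

theorem meanDist_eq_expectedDist (d : X → Y → ℝ) (x : Fin n → X) (z : Fin n → Z) (y : Fin n → Y) :
    meanDist d x y = expectedDist d fun a c b => 1 / n * (jointCnt x z y a c b : ℝ) := by
  have h := sum_comp_eq_sum_cnt (fun i => ((x i, z i), y i)) fun s => d s.1.1 s.2
  rw [meanDist, h, mul_sum, expectedDist, Fintype.sum_prod_type, Fintype.sum_prod_type]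
  simp only [mul_assoc, jointCnt]

theorem empirical_mem_couplings {d : X → Y → ℝ} {D : ℝ} {x : Fin n → X} {z : Fin n → Z}
    {y : Fin n → Y} (h : meanDist d x y ≤ D) :
    (fun a c b => 1 / (n : ℝ) * (jointCnt x z y a c b : ℝ)) ∈
      couplings d D (empirical n (cnt fun i => (x i, z i))) := by
  refine ⟨fun a c b => by positivity, fun a c => ?_, by rwa [← meanDist_eq_expectedDist]⟩
  rw [← mul_sum, ← Nat.cast_sum, sum_jointCnt_y, empirical]

theorem infoFn_jointCnt (hn : 0 < n) (x : Fin n → X) (z : Fin n → Z) (y : Fin n → Y) :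
    infoFn (fun a c b => (jointCnt x z y a c b : ℝ)) =
      n * infoFn fun a c b => 1 / (n : ℝ) * (jointCnt x z y a c b : ℝ) := by
  have hn' : (0 : ℝ) < n := by exact_mod_cast hn
  rw [← infoFn_smul (n : ℝ) hn' _ fun a c b => by positivity]
  congr 1
  funext a c b
  field_simp

open Classical in
/-- How much of the class of all `x` with the same joint type with `z` one guess can cover: a
fraction of about `exp (-n R)`. -/
theorem card_covered_le {d : X → Y → ℝ} {D : ℝ} (hn : 0 < n) (x : Fin n → X) (z : Fin n → Z)
    (y : Fin n → Y) :
    (#{x' ∈ sideClass z (cnt fun i => (x i, z i)) | meanDist d x' y ≤ D} : ℝ) ≤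
      #(sideClass z (cnt fun i => (x i, z i))) *
        Real.exp (-(n * rate d D (empirical n (cnt fun i => (x i, z i)))) +
          (infoErr X Y Z + Fintype.card ((Z × Y) × X)) * polyErr n) := by
  set k := cnt fun i => (x i, z i) with hk
  set U := {x' ∈ sideClass z k | meanDist d x' y ≤ D} with hU
  have hApos : (0 : ℝ) < #(sideClass z k) := by
    have hx : x ∈ sideClass z k := mem_sideClass.2 hk.symm
    exact_mod_cast card_pos.2 ⟨x, hx⟩
  set T := U.image fun x' => cnt fun i => ((z i, y i), x' i) with hT
  have hTc : (#T : ℝ) ≤ Real.exp (Fintype.card ((Z × Y) × X) * polyErr n) := by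
    have h1 : #T ≤ (n + 1) ^ Fintype.card ((Z × Y) × X) := by
      have h2 := card_image_cnt_le (U.image fun x' i => ((z i, y i), x' i))
      rwa [Fintype.card_fin, image_image] at h2
    have h3 := add_one_le_exp_polyErr n
    rw [Real.exp_nat_mul]
    calc (#T : ℝ) ≤ ((n : ℝ) + 1) ^ Fintype.card ((Z × Y) × X) := by exact_mod_cast h1
      _ ≤ _ := by gcongr
  have hclass : ∀ J ∈ T, (#(condClass (fun i => (z i, y i)) J) : ℝ) ≤
      #(sideClass z k) * Real.exp (-(n * rate d D (empirical n k)) +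
        infoErr X Y Z * polyErr n) := by
    intro J hJ
    obtain ⟨x', hx', rfl⟩ := mem_image.1 hJ
    rw [hU, mem_filter, mem_sideClass] at hx'
    obtain ⟨hx'k, hx'd⟩ := hx'
    have hpos := card_condClass_pos (fun i => (z i, y i)) (cnt fun i => ((z i, y i), x' i))
      fun s => sum_cnt_pair_right (fun i => (z i, y i)) x' s
    have hlog := log_card_condClass (fun i => (z i, y i)) (cnt fun i => ((z i, y i), x' i))
      fun s => sum_cnt_pair_right (fun i => (z i, y i)) x' s
    have hA := log_card_sideClass x' z
    have hest := (abs_le.1 (abs_log_factorials_sub_infoFn_le x' z y)).1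
    have hrate := rate_le (empirical_mem_couplings (z := z) hx'd)
    rw [infoFn_jointCnt hn, Fintype.card_fin] at hest
    rw [hx'k] at hA hest hrate
    have hsum := sum_jointCnt_perm x' z y fun m => Real.log m.factorial
    have hn' : (0 : ℝ) < n := by exact_mod_cast hn
    have hmul := mul_le_mul_of_nonneg_left hrate hn'.le
    rw [← Real.log_le_log_iff (by exact_mod_cast hpos) (by positivity),
      Real.log_mul hApos.ne' (Real.exp_pos _).ne', Real.log_exp, hlog, hA, hsum]
    linarith
  calc (#U : ℝ) = ∑ J ∈ T, (#{x' ∈ U | cnt (fun i => ((z i, y i), x' i)) = J} : ℝ) := by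
        exact_mod_cast card_eq_sum_card_image _ U
    _ ≤ ∑ _J ∈ T, #(sideClass z k) * Real.exp (-(n * rate d D (empirical n k)) +
          infoErr X Y Z * polyErr n) := by
        refine sum_le_sum fun J hJ => le_trans ?_ (hclass J hJ)
        have hsub : {x' ∈ U | cnt (fun i => ((z i, y i), x' i)) = J} ⊆
            condClass (fun i => (z i, y i)) J := fun x' hx' => mem_condClass.2 (mem_filter.1 hx').2
        exact_mod_cast card_le_card hsub
    _ = #T * (#(sideClass z k) * Real.exp (-(n * rate d D (empirical n k)) +
          infoErr X Y Z * polyErr n)) := by rw [sum_const, nsmul_eq_mul]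
    _ ≤ Real.exp (Fintype.card ((Z × Y) × X) * polyErr n) * (#(sideClass z k) *
          Real.exp (-(n * rate d D (empirical n k)) + infoErr X Y Z * polyErr n)) := by gcongr
    _ = _ := by
        rw [mul_left_comm, ← Real.exp_add]
        congr 2
        ring

end Empirical

/-! ### Covering conditional type classes -/

section Achievability

variable {X Y Z : Type*} [Fintype X] [Fintype Y] [Fintype Z]

/-- Rounding a coupling of an empirical distribution to a joint type, with the remainders sent to
distortion-free letters: some `y` satisfies the distortion constraint exactly and realizes the
coupling up to `O(1 / n)`. -/
theorem exists_realization {d : X → Y → ℝ} {D : ℝ} (hd : ∀ x y, 0 ≤ d x y) {y₀ : X → Y}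
    (hy₀ : ∀ x, d x (y₀ x) = 0) {n : ℕ} (hn : 0 < n) (x : Fin n → X) (z : Fin n → Z)
    {p : X → Z → Y → ℝ} (hp : p ∈ couplings d D (empirical n (cnt fun i => (x i, z i)))) :
    ∃ y : Fin n → Y, meanDist d x y ≤ D ∧
      ∀ a c b, |1 / (n : ℝ) * jointCnt x z y a c b - p a c b| ≤
        1 / n + Fintype.card Y * (1 / n) := by
  classical
  have hn' : (0 : ℝ) < n := by exact_mod_cast hn
  set k := cnt fun i => (x i, z i) with hk
  have hfl : ∀ a c b, (⌊n * p a c b⌋₊ : ℝ) ≤ n * p a c b := fun a c b =>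
    Nat.floor_le (mul_nonneg hn'.le (hp.1 a c b))
  have hfl' : ∀ a c b, n * p a c b < ⌊n * p a c b⌋₊ + 1 := fun a c b => Nat.lt_floor_add_one _
  have hsum : ∀ a c, ∑ b, n * p a c b = k (a, c) := fun a c => by
    rw [← mul_sum, hp.2.1, empirical]; field_simp
  have hle : ∀ a c, ∑ b, ⌊n * p a c b⌋₊ ≤ k (a, c) := fun a c => by
    have : ∑ b, (⌊n * p a c b⌋₊ : ℝ) ≤ k (a, c) :=
      (sum_le_sum fun b _ => hfl a c b).trans_eq (hsum a c)
    exact_mod_cast this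
  let J : (X × Z) × Y → ℕ := fun s => ⌊n * p s.1.1 s.1.2 s.2⌋₊ +
    if s.2 = y₀ s.1.1 then k s.1 - ∑ b, ⌊n * p s.1.1 s.1.2 b⌋₊ else 0
  have hJ : ∀ a, ∑ b, J (a, b) = cnt (fun i => (x i, z i)) a := fun a => by
    have := hle a.1 a.2
    simp only [J, sum_add_distrib, sum_ite_eq', mem_univ, if_true]
    exact Nat.add_sub_cancel' this
  obtain ⟨y, hy⟩ := exists_cnt_pair_eq _ J hJ
  let s : X → Z → Y → ℝ := fun a c b => 1 / n * (⌊n * p a c b⌋₊ : ℝ)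
  have hemp : (fun a c b => 1 / (n : ℝ) * (jointCnt x z y a c b : ℝ)) =
      complete y₀ (empirical n k) s := by
    funext a c b
    rw [jointCnt, hy]
    simp only [J, complete, s, empirical]
    rw [← mul_sum]
    have h1 : ((k (a, c) - ∑ b, ⌊n * p a c b⌋₊ : ℕ) : ℝ) =
        k (a, c) - ∑ b, (⌊n * p a c b⌋₊ : ℝ) := by
      rw [Nat.cast_sub (hle a c)]; push_cast; rfl
    split_ifs
    · push_cast [h1]; ring
    · push_cast; ring
  have hs0 : ∀ a c b, 0 ≤ s a c b := fun a c b => by positivity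
  have hsp : ∀ a c b, s a c b ≤ p a c b := fun a c b => by
    have := hfl a c b
    simp only [s]
    rw [one_div, inv_mul_le_iff₀ hn']
    exact this
  have hsp' : ∀ a c b, p a c b - s a c b ≤ 1 / n := fun a c b => by
    have := hfl' a c b
    simp only [s]
    generalize (⌊n * p a c b⌋₊ : ℝ) = F at this ⊢
    have e : 1 / (n : ℝ) * F * n = F := by field_simp
    rw [le_div_iff₀ hn', sub_mul, e, mul_comm]
    linarith
  have hsq : ∀ a c, ∑ b, s a c b ≤ empirical n k (a, c) := fun a c =>
    (sum_le_sum fun b _ => hsp a c b).trans_eq (hp.2.1 a c)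
  refine ⟨y, ?_, fun a c b => ?_⟩
  · rw [meanDist_eq_expectedDist d x z y, hemp]
    exact (complete_mem_couplings hd hy₀ hp.2.2 hs0 hsp hsq).2.2
  · rw [congrFun (congrFun (congrFun hemp a) c) b]
    refine abs_complete_sub_le a c b ?_ ?_
    · rw [abs_sub_comm, abs_of_nonneg (sub_nonneg.2 (hsp a c b))]
      exact hsp' a c b
    · rw [abs_of_nonneg (sub_nonneg.2 (hsq a c)), ← hp.2.1 a c, ← sum_sub_distrib,
        ← nsmul_eq_mul, ← card_univ]
      exact sum_le_card_nsmul _ _ _ fun b _ => hsp' a c b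

/-- Covering a conditional type class. If `y` meets the distortion constraint for `x`, then every
other `x'` in the class is as close to as many members of the class of `y`, so the greedy cover has
size about `exp (n I)` for the empirical mutual information `I`. -/
theorem exists_cover_sideClass {d : X → Y → ℝ} {D : ℝ} {n : ℕ} (hn : 0 < n) (x : Fin n → X)
    (z : Fin n → Z) (y : Fin n → Y) (hy : meanDist d x y ≤ D) :
    ∃ C : Finset (Fin n → Y),
      (#C : ℝ) ≤ Real.exp (infoFn (fun a c b => (jointCnt x z y a c b : ℝ)) +
        (infoErr X Y Z + Fintype.card X + 1) * polyErr n) ∧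
      ∀ x' ∈ sideClass z (cnt fun i => (x i, z i)), ∃ y' ∈ C, meanDist d x' y' ≤ D := by
  classical
  set A := sideClass z (cnt fun i => (x i, z i)) with hA
  set J := cnt fun i => ((x i, z i), y i) with hJdef
  set B := condClass z (cnt fun i => (z i, y i)) with hB
  have hJ : ∀ x' ∈ A, ∀ a, ∑ b, J (a, b) = cnt (fun i => (x' i, z i)) a := fun x' hx' a => by
    rw [mem_sideClass.1 hx']
    exact sum_cnt_pair_right (fun i => (x i, z i)) y a
  have hx : x ∈ A := mem_sideClass.2 rfl
  set N := #(condClass (fun i => (x i, z i)) J) with hN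
  have hNpos : 0 < N := card_condClass_pos _ _ (hJ x hx)
  have hcard : ∀ x' ∈ A, #(condClass (fun i => (x' i, z i)) J) = N := fun x' hx' => by
    have h1 := card_condClass_mul _ _ (hJ x' hx')
    have h2 := card_condClass_mul _ _ (hJ x hx)
    rw [mem_sideClass.1 hx', ← h2] at h1
    exact Nat.eq_of_mul_eq_mul_right (prod_pos fun s _ => (J s).factorial_pos) h1
  have hsub : ∀ x' ∈ A, condClass (fun i => (x' i, z i)) J ⊆ {y' ∈ B | meanDist d x' y' ≤ D} := by
    intro x' hx' y' hy'
    rw [mem_condClass] at hy'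
    have hjc : jointCnt x' z y' = jointCnt x z y := by
      funext a c b
      rw [jointCnt, jointCnt, hy']
    refine mem_filter.2 ⟨mem_condClass.2 ?_, ?_⟩
    · funext ⟨c, b⟩
      rw [← sum_jointCnt_x x' z y', ← sum_jointCnt_x x z y, hjc]
    · rw [meanDist_eq_expectedDist d x' z y', hjc, ← meanDist_eq_expectedDist]
      exact hy
  have hdeg : ∀ x' ∈ A, (N : ℝ) ≤ #{y' ∈ B | meanDist d x' y' ≤ D} := fun x' hx' => by
    rw [← hcard x' hx']
    exact_mod_cast card_le_card (hsub x' hx')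
  have hNr : (0 : ℝ) < N := by exact_mod_cast hNpos
  obtain ⟨C, hC, hcov⟩ := exists_cover A B (fun x' y' => meanDist d x' y' ≤ D) N hNr hdeg
  refine ⟨C, hC.trans ?_, hcov⟩
  have hNB : (N : ℝ) ≤ #B := (hdeg x hx).trans (by exact_mod_cast card_filter_le _ _)
  have hBpos : (0 : ℝ) < #B := hNr.trans_le hNB
  set u := infoFn (fun a c b => (jointCnt x z y a c b : ℝ)) + infoErr X Y Z * polyErr n with hu
  have hratio : (#B : ℝ) / N ≤ Real.exp u := by
    rw [← Real.log_le_iff_le_exp (div_pos hBpos hNr), Real.log_div hBpos.ne' hNr.ne',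
      log_card_condClass _ _ (hJ x hx),
      log_card_condClass _ _ fun c => sum_cnt_pair_right z y c]
    have hest := (abs_le.1 (abs_log_factorials_sub_infoFn_le x z y)).2
    rw [Fintype.card_fin] at hest
    linarith
  have hone : 1 ≤ Real.exp u := ((one_le_div hNr).2 hNB).trans hratio
  have hlogA : Real.log #A ≤ n * Fintype.card X := by
    have hXpos : 0 < Fintype.card X := Fintype.card_pos_iff.2 ⟨x ⟨0, hn⟩⟩
    have h1 : #A ≤ Fintype.card X ^ n := by
      refine (card_le_univ A).trans_eq ?_
      rw [Fintype.card_fun, Fintype.card_fin]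
    have hApos : 0 < #A := card_pos.2 ⟨x, hx⟩
    calc Real.log #A ≤ Real.log ((Fintype.card X : ℝ) ^ n) :=
          Real.log_le_log (by exact_mod_cast hApos) (by exact_mod_cast h1)
      _ = n * Real.log (Fintype.card X) := Real.log_pow _ _
      _ ≤ n * Fintype.card X := by
          gcongr
          exact Real.log_le_self (Nat.cast_nonneg _)
  have hpoly : (n : ℝ) * Fintype.card X + 1 ≤
      Real.exp ((Fintype.card X + 1) * polyErr n) := by
    have h1 := add_one_le_exp_polyErr n
    have h2 : (Fintype.card X : ℝ) + 1 ≤ Real.exp (Fintype.card X * polyErr n) :=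
      (Real.add_one_le_exp _).trans (Real.exp_le_exp.2
        (le_mul_of_one_le_right (Nat.cast_nonneg _) (one_le_polyErr n)))
    have h3 : (n : ℝ) * Fintype.card X + 1 ≤ (Fintype.card X + 1) * (n + 1) := by
      nlinarith [(Nat.cast_nonneg n : (0 : ℝ) ≤ n),
        (Nat.cast_nonneg (Fintype.card X) : (0 : ℝ) ≤ Fintype.card X)]
    rw [add_mul, Real.exp_add, one_mul]
    refine h3.trans ?_
    gcongr
  calc (#B : ℝ) / N * Real.log #A + 1
      ≤ Real.exp u * (n * Fintype.card X) + Real.exp u := by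
        have := Real.log_natCast_nonneg #A
        gcongr
    _ = Real.exp u * (n * Fintype.card X + 1) := by ring
    _ ≤ Real.exp u * Real.exp ((Fintype.card X + 1) * polyErr n) := by gcongr
    _ = _ := by
        rw [← Real.exp_add, hu]
        congr 1
        ring

/-- Type covering with side information, uniformly over all joint types. -/
theorem eventually_exists_cover {d : X → Y → ℝ} {D : ℝ} (hd : ∀ x y, 0 ≤ d x y) {y₀ : X → Y}
    (hy₀ : ∀ x, d x (y₀ x) = 0) (hD : 0 ≤ D) (ε : ℝ) (hε : 0 < ε) :
    ∀ᶠ n : ℕ in Filter.atTop, ∀ (z : Fin n → Z) (k : X × Z → ℕ),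
      ∃ C : Finset (Fin n → Y), (#C : ℝ) ≤ Real.exp (n * (rate d D (empirical n k) + ε)) ∧
        ∀ x ∈ sideClass z k, ∃ y ∈ C, meanDist d x y ≤ D := by
  obtain ⟨δ, hδ, hmod⟩ := exists_infoFn_modulus (X := X) (Y := Y) (Z := Z) (ε / 2) (half_pos hε)
  have hlim : Filter.Tendsto (fun n : ℕ => 1 / (n : ℝ) + Fintype.card Y * (1 / (n : ℝ)))
      Filter.atTop (nhds 0) := by
    have := tendsto_one_div_atTop_nhds_zero_nat (𝕜 := ℝ)
    simpa using this.add (this.const_mul (Fintype.card Y : ℝ))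
  filter_upwards [hlim.eventually_lt_const hδ, Filter.eventually_gt_atTop 0,
    eventually_polyErr_le (infoErr X Y Z + Fintype.card X + 1) (ε / 2) (half_pos hε)]
    with n hnδ hn hnε z k
  rcases (sideClass z k).eq_empty_or_nonempty with he | ⟨x, hx⟩
  · exact ⟨∅, by simpa using (Real.exp_pos _).le, by simp [he]⟩
  have hxk := mem_sideClass.1 hx
  have hq : empirical n (cnt fun i => (x i, z i)) ∈ stdSimplex ℝ (X × Z) :=
    empirical_mem_stdSimplex hn (by rw [sum_cnt, Fintype.card_fin])
  obtain ⟨p, hp, hpr⟩ := exists_rate_eq hd hy₀ hD hq.1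
  obtain ⟨y, hy, hclose⟩ := exists_realization hd hy₀ hn x z hp
  obtain ⟨C, hC, hcov⟩ := exists_cover_sideClass hn x z y hy
  refine ⟨C, hC.trans (Real.exp_le_exp.2 ?_), by rwa [hxk] at hcov⟩
  have hI : ∀ {p}, p ∈ couplings d D (empirical n (cnt fun i => (x i, z i))) →
      ∀ a c b, p a c b ∈ Set.Icc (0 : ℝ) 1 := fun hp a c b =>
    ⟨hp.1 a c b, (le_of_mem_couplings hp a c b).trans (mem_Icc_of_mem_stdSimplex hq _).2⟩
  have := (abs_lt.1 (hmod _ _ (hI (empirical_mem_couplings (z := z) hy)) (hI hp)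
    fun a c b => (hclose a c b).trans_lt hnδ)).2
  rw [hpr, hxk] at this
  have hn' : (0 : ℝ) < n := by exact_mod_cast hn
  rw [infoFn_jointCnt hn]
  nlinarith

end Achievability

/-! ### Probabilities of types and the exponent -/

section Probability

variable {A : Type*} [Fintype A]

theorem prod_eq_ofReal_exp {n : ℕ} (P : PMF A) (w : Fin n → A) (hw : ∀ i, P (w i) ≠ 0) :
    ∏ i, P (w i) = ENNReal.ofReal (Real.exp (∑ a, (cnt w a : ℝ) * Real.log (realMass P a))) := by
  rw [← sum_comp_eq_sum_cnt w fun a => Real.log (realMass P a), Real.exp_sum,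
    ENNReal.ofReal_prod_of_nonneg fun i _ => (Real.exp_pos _).le]
  refine prod_congr rfl fun i _ => ?_
  have h0 : 0 < realMass P (w i) := lt_of_le_of_ne ENNReal.toReal_nonneg
    fun h => hw i ((realMass_eq_zero_iff P _).1 h.symm)
  rw [Real.exp_log h0, realMass, ENNReal.ofReal_toReal (P.apply_ne_top _)]

theorem klFn_empirical {n : ℕ} (hn : 0 < n) (P : PMF A) {k : A → ℕ} (hk : ∑ a, k a = n) :
    n * klFn P (empirical n k) = ∑ a, (k a : ℝ) * Real.log (k a) - n * Real.log n -
      ∑ a, (k a : ℝ) * Real.log (realMass P a) := by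
  have hn' : (0 : ℝ) < n := by exact_mod_cast hn
  have h1 : (n : ℝ) * Real.log n = ∑ a, (k a : ℝ) * Real.log n := by
    rw [← sum_mul, ← Nat.cast_sum, hk]
  rw [h1, klFn, mul_sum, ← sum_sub_distrib, ← sum_sub_distrib]
  refine sum_congr rfl fun a _ => ?_
  rw [empirical]
  rcases Nat.eq_zero_or_pos (k a) with h0 | h0
  · simp [h0]
  have h0' : (0 : ℝ) < k a := by exact_mod_cast h0
  rw [one_div_mul_eq_div, Real.log_div h0'.ne' hn'.ne']
  field_simp

/-- A type class has probability `exp (-n D(q ‖ P))` up to polynomial factors, where `q` is the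
empirical distribution. -/
theorem abs_log_prob_typeClass_le {n : ℕ} (hn : 0 < n) (P : PMF A) {k : A → ℕ}
    (hk : ∑ a, k a = n) :
    |Real.log #(typeClass (Fin n) k) + ∑ a, (k a : ℝ) * Real.log (realMass P a) +
      n * klFn P (empirical n k)| ≤ (1 + Fintype.card A) * polyErr n := by
  have hk' : ∑ a, k a = Fintype.card (Fin n) := by rw [hk, Fintype.card_fin]
  have h1 := abs_le.1 (abs_sum_log_factorial_sub_le k n hk)
  have h2 := mul_log_sub_le_log_factorial n
  have h3 := log_factorial_le n
  have h4 := polyErr_nonneg n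
  rw [klFn_empirical hn P hk, log_card_typeClass hk', Fintype.card_fin, abs_le]
  constructor <;> linarith [h1.1, h1.2]

/-- Every law is a limit of empirical distributions of sequences of letters from its support. -/
theorem exists_empirical_near {q : A → ℝ} (hq : q ∈ stdSimplex ℝ A) {n : ℕ} (hn : 0 < n) :
    ∃ k : A → ℕ, ∑ a, k a = n ∧ (∀ a, q a = 0 → k a = 0) ∧
      ∀ a, |empirical n k a - q a| ≤ 1 / n + Fintype.card A * (1 / n) := by
  classical
  have hn' : (0 : ℝ) < n := by exact_mod_cast hn
  obtain ⟨a₀, ha₀⟩ : ∃ a, q a ≠ 0 := by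
    by_contra h
    push Not at h
    have := hq.2
    simp [h] at this
  have hfl : ∀ a, (⌊n * q a⌋₊ : ℝ) ≤ n * q a := fun a => Nat.floor_le (mul_nonneg hn'.le (hq.1 a))
  have hfl' : ∀ a, n * q a < ⌊n * q a⌋₊ + 1 := fun a => Nat.lt_floor_add_one _
  have hsum : ∑ a, n * q a = n := by rw [← mul_sum, hq.2, mul_one]
  have hle : ∑ a, ⌊n * q a⌋₊ ≤ n := by
    have : ∑ a, (⌊n * q a⌋₊ : ℝ) ≤ n := (sum_le_sum fun a _ => hfl a).trans_eq hsum
    exact_mod_cast this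
  have hrem : ((n - ∑ a, ⌊n * q a⌋₊ : ℕ) : ℝ) ≤ Fintype.card A := by
    rw [Nat.cast_sub hle, Nat.cast_sum]
    calc (n : ℝ) - ∑ a, (⌊n * q a⌋₊ : ℝ) = ∑ a, (n * q a - ⌊n * q a⌋₊) := by
          rw [sum_sub_distrib, hsum]
      _ ≤ ∑ _a : A, (1 : ℝ) := sum_le_sum fun a _ => by linarith [hfl' a]
      _ = Fintype.card A := by simp
  refine ⟨fun a => ⌊n * q a⌋₊ + if a = a₀ then n - ∑ a, ⌊n * q a⌋₊ else 0, ?_, ?_, ?_⟩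
  · simp only [sum_add_distrib, sum_ite_eq', mem_univ, if_true]
    exact Nat.add_sub_cancel' hle
  · intro a ha
    have : a ≠ a₀ := fun h => ha₀ (h ▸ ha)
    simp [ha, this]
  · intro a
    have e1 : |1 / (n : ℝ) * ⌊n * q a⌋₊ - q a| ≤ 1 / n := by
      have h1 := hfl a
      have h2 := hfl' a
      have h3 : 1 / (n : ℝ) * ⌊n * q a⌋₊ - q a = 1 / n * (⌊n * q a⌋₊ - n * q a) := by
        field_simp
      rw [h3, abs_mul, abs_of_pos (by positivity)]
      refine mul_le_of_le_one_right (by positivity) ?_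
      rw [abs_le]
      constructor <;> linarith
    simp only [empirical, Nat.cast_add, mul_add]
    rw [add_sub_right_comm]
    refine (abs_add_le _ _).trans (add_le_add e1 ?_)
    rw [abs_of_nonneg (by positivity), mul_comm (Fintype.card A : ℝ)]
    refine mul_le_mul_of_nonneg_left ?_ (by positivity)
    split_ifs
    · exact hrem
    · simp

end Probability

section Exponent

variable {X Y Z : Type*} [Fintype X] [Fintype Y] [Fintype Z]

theorem sum_sum_eq_sum_pairs {n : ℕ} (f : (Fin n → X) → (Fin n → Z) → ℝ≥0∞) :
    ∑ x, ∑ z, f x z = ∑ w : Fin n → X × Z, f (fun i => (w i).1) fun i => (w i).2 := by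
  rw [← Fintype.sum_prod_type' f]
  exact (Fintype.sum_equiv (Equiv.arrowProdEquivProdArrow (Fin n) (fun _ => X) fun _ => Z) _ _
    fun _ => rfl).symm

/-- Achievability: the adversary lists the covers of all conditional type classes, the small ones
first. -/
theorem eventually_exists_strategy {d : X → Y → ℝ} {D : ℝ} (hd : ∀ x y, 0 ≤ d x y) {y₀ : X → Y}
    (hy₀ : ∀ x, d x (y₀ x) = 0) (hD : 0 ≤ D) (P : PMF (X × Z)) {E : ℝ}
    (hE : ∀ q ∈ stdSimplex ℝ (X × Z), (∀ a, P a = 0 → q a = 0) → rate d D q - klFn P q ≤ E)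
    (ε : ℝ) (hε : 0 < ε) :
    ∀ᶠ n : ℕ in Filter.atTop, ∃ S : Strategy Y Z n,
      expectedCount d D P S ≤ ENNReal.ofReal (Real.exp (n * (E + ε))) := by
  classical
  filter_upwards [eventually_exists_cover (Z := Z) hd hy₀ hD (ε / 2) (half_pos hε),
    Filter.eventually_gt_atTop 0,
    eventually_polyErr_le (1 + 3 * Fintype.card (X × Z)) (ε / 2) (half_pos hε)] with n hcov hn herr
  choose C hC hCcov using hcov
  set T : Finset (X × Z → ℕ) := (univ : Finset (Fin n → X × Z)).image cnt with hT
  have hTc : (#T : ℝ) ≤ Real.exp (Fintype.card (X × Z) * polyErr n) := by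
    have h1 := card_image_cnt_le (univ : Finset (Fin n → X × Z))
    rw [Fintype.card_fin] at h1
    have h3 := add_one_le_exp_polyErr n
    rw [Real.exp_nat_mul]
    calc (#T : ℝ) ≤ ((n : ℝ) + 1) ^ Fintype.card (X × Z) := by exact_mod_cast h1
      _ ≤ _ := by gcongr
  choose l hnd _ hl using fun z => exists_nodup_list T (C z)
  let S : Strategy Y Z n := fun z => ⟨l z, hnd z⟩
  refine ⟨S, ?_⟩
  have hcount : ∀ w : Fin n → X × Z, count d D (S fun i => (w i).2) (fun i => (w i).1) ≤
      ENNReal.ofReal (#T * Real.exp (n * (rate d D (empirical n (cnt w)) + ε / 2))) := by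
    intro w
    have hwT : cnt w ∈ T := mem_image_of_mem _ (mem_univ w)
    obtain ⟨y, hyC, hy⟩ := hCcov (fun i => (w i).2) (cnt w) (fun i => (w i).1)
      (mem_sideClass.2 rfl)
    obtain ⟨j, hj, hjle⟩ := hl (fun i => (w i).2) (cnt w) hwT y hyC
    refine (iInf₂_le j (by rw [← hj] at hy; exact hy)).trans ?_
    have h1 : ((j : ℕ) : ℝ≥0∞) + 1 = ENNReal.ofReal ((j : ℕ) + 1) := by
      rw [ENNReal.ofReal_add (by positivity) zero_le_one]; simp
    rw [h1]
    apply ENNReal.ofReal_le_ofReal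
    calc ((j : ℕ) : ℝ) + 1 ≤ #T * #(C (fun i => (w i).2) (cnt w)) := by exact_mod_cast hjle
      _ ≤ _ := by gcongr; exact hC _ _
  -- each sequence contributes at most `M` divided by the size of its type class
  set M : ℝ := Real.exp (n * (E + ε / 2) + (1 + 2 * Fintype.card (X × Z)) * polyErr n) with hM
  have hterm : ∀ w : Fin n → X × Z,
      (∏ i, P (w i)) * count d D (S fun i => (w i).2) (fun i => (w i).1) ≤
        ENNReal.ofReal (M / #(typeClass (Fin n) (cnt w))) := by
    intro w
    by_cases hw : ∀ i, P (w i) ≠ 0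
    · have hk : ∑ a, cnt w a = n := by rw [sum_cnt, Fintype.card_fin]
      have hq := empirical_mem_stdSimplex hn hk
      have hac : ∀ a, P a = 0 → empirical n (cnt w) a = 0 := fun a ha => by
        have : cnt w a = 0 := (cnt_eq_zero_iff w a).2 fun i hi => hw i (hi ▸ ha)
        rw [empirical, this]; simp
      have hval := hE _ hq hac
      have hprob := (abs_le.1 (abs_log_prob_typeClass_le hn P hk)).2
      have hTpos : (0 : ℝ) < #(typeClass (Fin n) (cnt w)) := by
        have : w ∈ typeClass (Fin n) (cnt w) := mem_typeClass.2 rfl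
        exact_mod_cast card_pos.2 ⟨w, this⟩
      rw [prod_eq_ofReal_exp P w hw]
      refine (mul_le_mul_right (hcount w) _).trans ?_
      rw [← ENNReal.ofReal_mul (Real.exp_pos _).le]
      apply ENNReal.ofReal_le_ofReal
      rw [le_div_iff₀ hTpos]
      have hn' : (0 : ℝ) < n := by exact_mod_cast hn
      set K := ∑ a, (cnt w a : ℝ) * Real.log (realMass P a)
      set R := rate d D (empirical n (cnt w))
      calc Real.exp K * (#T * Real.exp (n * (R + ε / 2))) * #(typeClass (Fin n) (cnt w))
          ≤ Real.exp K * (Real.exp (Fintype.card (X × Z) * polyErr n) *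
              Real.exp (n * (R + ε / 2))) *
              Real.exp (Real.log #(typeClass (Fin n) (cnt w))) := by
            rw [Real.exp_log hTpos]
            gcongr
        _ = Real.exp (K + (Fintype.card (X × Z) * polyErr n + n * (R + ε / 2)) +
              Real.log #(typeClass (Fin n) (cnt w))) := by
            simp only [Real.exp_add]
        _ ≤ M := by
            refine Real.exp_le_exp.2 ?_
            nlinarith [mul_le_mul_of_nonneg_left hval hn'.le]
    · push Not at hw
      obtain ⟨i, hi⟩ := hw
      rw [prod_eq_zero (mem_univ i) hi, zero_mul]
      exact zero_le
  calc expectedCount d D P S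
      = ∑ w : Fin n → X × Z,
          (∏ i, P (w i)) * count d D (S fun i => (w i).2) (fun i => (w i).1) :=
        sum_sum_eq_sum_pairs fun x z => (∏ i, P (x i, z i)) * count d D (S z) x
    _ ≤ ∑ w : Fin n → X × Z, ENNReal.ofReal (M / #(typeClass (Fin n) (cnt w))) :=
        sum_le_sum fun w _ => hterm w
    _ = ENNReal.ofReal (∑ w : Fin n → X × Z, M / #(typeClass (Fin n) (cnt w))) :=
        (ENNReal.ofReal_sum_of_nonneg fun w _ => by positivity).symm
    _ ≤ ENNReal.ofReal (Real.exp (n * (E + ε))) := by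
        apply ENNReal.ofReal_le_ofReal
        calc ∑ w : Fin n → X × Z, M / #(typeClass (Fin n) (cnt w))
            = ∑ k ∈ T, ∑ w : Fin n → X × Z with cnt w = k,
                M / #(typeClass (Fin n) (cnt w)) := by
              rw [sum_fiberwise_of_maps_to fun w hw => mem_image_of_mem _ hw]
          _ ≤ ∑ _k ∈ T, M := by
              refine sum_le_sum fun k hk => ?_
              obtain ⟨w₀, -, rfl⟩ := mem_image.1 hk
              have hpos : (0 : ℝ) < #(typeClass (Fin n) (cnt w₀)) := by
                have : w₀ ∈ typeClass (Fin n) (cnt w₀) := mem_typeClass.2 rfl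
                exact_mod_cast card_pos.2 ⟨w₀, this⟩
              have heq : ({w | cnt w = cnt w₀} : Finset (Fin n → X × Z)) =
                  typeClass (Fin n) (cnt w₀) := by
                ext w; simp [mem_typeClass]
              rw [sum_congr rfl (g := fun _ => M / #(typeClass (Fin n) (cnt w₀)))
                (fun w hw => by rw [(mem_filter.1 hw).2]), sum_const, nsmul_eq_mul, heq,
                mul_div_cancel₀ _ hpos.ne']
          _ = #T * M := by rw [sum_const, nsmul_eq_mul]
          _ ≤ Real.exp (Fintype.card (X × Z) * polyErr n) * M := by gcongr
          _ ≤ Real.exp (n * (E + ε)) := by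
              rw [hM, ← Real.exp_add]
              refine Real.exp_le_exp.2 ?_
              nlinarith

/-- Any list of guesses needs on average about `exp (n R)` attempts on a conditional type class. -/
theorem le_sum_count_sideClass {d : X → Y → ℝ} {D : ℝ} {n : ℕ} (hn : 0 < n) (S : GuessList Y n)
    (z : Fin n → Z) (k : X × Z → ℕ) :
    ENNReal.ofReal (#(sideClass z k) * Real.exp (n * rate d D (empirical n k) -
      (infoErr X Y Z + Fintype.card ((Z × Y) × X) + 2) * polyErr n)) ≤
      ∑ x ∈ sideClass z k, count d D S x := by
  rcases (sideClass z k).eq_empty_or_nonempty with he | ⟨x, hx⟩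
  · simp [he]
  obtain rfl := mem_sideClass.1 hx
  have hApos : (0 : ℝ) < #(sideClass z (cnt fun i => (x i, z i))) := by
    exact_mod_cast card_pos.2 ⟨x, hx⟩
  refine le_trans (ENNReal.ofReal_le_ofReal ?_) (le_sum_count d D S _ _
    (mul_pos hApos (Real.exp_pos _)) fun y => by
      convert card_covered_le (d := d) (D := D) hn x z y)
  refine mul_le_mul_of_nonneg_left ?_ hApos.le
  set r := rate d D (empirical n (cnt fun i => (x i, z i)))
  set e := infoErr X Y Z + (Fintype.card ((Z × Y) × X) : ℝ)
  have h4 : (4 : ℝ) ≤ Real.exp (2 * polyErr n) := by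
    have h2 : (2 : ℝ) ≤ Real.exp (polyErr n) := by
      linarith [Real.add_one_le_exp (polyErr n), one_le_polyErr n]
    rw [two_mul, Real.exp_add]
    nlinarith
  rw [mul_left_comm, ← div_div, div_self hApos.ne', le_div_iff₀ (by positivity)]
  calc Real.exp (n * r - (e + 2) * polyErr n) * (4 * Real.exp (-(n * r) + e * polyErr n))
      ≤ Real.exp (n * r - (e + 2) * polyErr n) *
          (Real.exp (2 * polyErr n) * Real.exp (-(n * r) + e * polyErr n)) := by gcongr
    _ = 1 := by
        rw [← Real.exp_add, ← Real.exp_add, Real.exp_eq_one_iff]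
        ring

/-- Converse: on the class of all pairs of a type near `q`, no strategy does better. -/
theorem eventually_le_expectedCount {d : X → Y → ℝ} {D : ℝ} (hd : ∀ x y, 0 ≤ d x y) {y₀ : X → Y}
    (hy₀ : ∀ x, d x (y₀ x) = 0) (hD : 0 ≤ D) (P : PMF (X × Z)) {q : X × Z → ℝ}
    (hq : q ∈ stdSimplex ℝ (X × Z)) (hqP : ∀ a, P a = 0 → q a = 0) (ε : ℝ) (hε : 0 < ε) :
    ∀ᶠ n : ℕ in Filter.atTop, ∀ S : Strategy Y Z n,
      ENNReal.ofReal (Real.exp (n * (rate d D q - klFn P q - ε))) ≤ expectedCount d D P S := by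
  classical
  obtain ⟨δ, hδ, hnear⟩ := Metric.continuousWithinAt_iff.1
    (((continuousOn_rate hd hy₀ hD).sub (continuous_klFn P).continuousOn) q hq) (ε / 2)
    (half_pos hε)
  have hlim : Filter.Tendsto (fun n : ℕ => 1 / (n : ℝ) + Fintype.card (X × Z) * (1 / (n : ℝ)))
      Filter.atTop (nhds 0) := by
    have := tendsto_one_div_atTop_nhds_zero_nat (𝕜 := ℝ)
    simpa using this.add (this.const_mul (Fintype.card (X × Z) : ℝ))
  filter_upwards [hlim.eventually_lt_const hδ, Filter.eventually_gt_atTop 0,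
    eventually_polyErr_le (infoErr X Y Z + Fintype.card ((Z × Y) × X) + 2 +
      (1 + Fintype.card (X × Z))) (ε / 2) (half_pos hε)] with n hnδ hn herr S
  have hn' : (0 : ℝ) < n := by exact_mod_cast hn
  obtain ⟨k, hk, hkq, hclose⟩ := exists_empirical_near hq hn
  have hkS := empirical_mem_stdSimplex hn hk
  have hkP : ∀ a, P a = 0 → k a = 0 := fun a ha => hkq a (hqP a ha)
  have hval := (abs_lt.1 (hnear hkS ((dist_pi_lt_iff hδ).2 fun a => (hclose a).trans_lt hnδ))).1
  simp only [Pi.sub_apply] at hval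
  have hprob := (abs_le.1 (abs_log_prob_typeClass_le hn P hk)).1
  have hTpos : (0 : ℝ) < #(typeClass (Fin n) k) := by
    exact_mod_cast card_typeClass_pos (ι := Fin n) (by rw [hk, Fintype.card_fin])
  set K := ∑ a, (k a : ℝ) * Real.log (realMass P a) with hK
  set r := rate d D (empirical n k) with hr
  set e := infoErr X Y Z + (Fintype.card ((Z × Y) × X) : ℝ) + 2 with he
  have hprod : ∀ (x : Fin n → X) (z : Fin n → Z), x ∈ sideClass z k →
      ∏ i, P (x i, z i) = ENNReal.ofReal (Real.exp K) := fun x z hx => by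
    rw [mem_sideClass] at hx
    rw [prod_eq_ofReal_exp P (fun i => (x i, z i)), hx]
    intro i hi
    have h0 := hkP _ hi
    rw [← hx, cnt_eq_zero_iff] at h0
    exact h0 i rfl
  have hclass : ∑ z : Fin n → Z, #(sideClass z k) = #(typeClass (Fin n) k) := by
    rw [← card_sigma]
    refine card_bij (fun s _ i => (s.2 i, s.1 i)) (fun s hs => ?_) (fun s _ t _ h => ?_)
      (fun w hw => ?_)
    · exact mem_typeClass.2 (mem_sideClass.1 (mem_sigma.1 hs).2)
    · have h1 : s.1 = t.1 := funext fun i => congrArg Prod.snd (congrFun h i)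
      have h2 : s.2 = t.2 := funext fun i => congrArg Prod.fst (congrFun h i)
      exact Sigma.ext h1 (heq_of_eq h2)
    · exact ⟨⟨fun i => (w i).2, fun i => (w i).1⟩,
        mem_sigma.2 ⟨mem_univ _, mem_sideClass.2 (mem_typeClass.1 hw)⟩, rfl⟩
  calc ENNReal.ofReal (Real.exp (n * (rate d D q - klFn P q - ε)))
      ≤ ENNReal.ofReal (Real.exp K * (#(typeClass (Fin n) k) *
          Real.exp (n * r - e * polyErr n))) := by
        apply ENNReal.ofReal_le_ofReal
        rw [← Real.exp_log hTpos, ← Real.exp_add, ← Real.exp_add]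
        refine Real.exp_le_exp.2 ?_
        nlinarith [mul_le_mul_of_nonneg_left hval.le hn'.le]
    _ = ENNReal.ofReal (Real.exp K) * ∑ z : Fin n → Z,
          ENNReal.ofReal (#(sideClass z k) * Real.exp (n * r - e * polyErr n)) := by
        rw [ENNReal.ofReal_mul (Real.exp_pos _).le,
          ← ENNReal.ofReal_sum_of_nonneg fun z _ => by positivity, ← sum_mul, ← hclass,
          Nat.cast_sum]
    _ ≤ ENNReal.ofReal (Real.exp K) * ∑ z : Fin n → Z, ∑ x ∈ sideClass z k, count d D (S z) x :=
        mul_le_mul_right (sum_le_sum fun z _ => le_sum_count_sideClass hn (S z) z k) _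
    _ = ∑ z : Fin n → Z, ∑ x ∈ sideClass z k, (∏ i, P (x i, z i)) * count d D (S z) x := by
        rw [mul_sum]
        refine sum_congr rfl fun z _ => ?_
        rw [mul_sum]
        exact sum_congr rfl fun x hx => by rw [hprod x z hx]
    _ ≤ ∑ z : Fin n → Z, ∑ x : Fin n → X, (∏ i, P (x i, z i)) * count d D (S z) x :=
        sum_le_sum fun z _ => sum_le_sum_of_subset (subset_univ _)
    _ = expectedCount d D P S := sum_comm

/-- Both bounds hold for all large `n`, so the normalized logarithms converge and their limit
inferior is the maximum. -/
theorem deceptionExponent_eq {d : X → Y → ℝ} {D : ℝ} (hd : ∀ x y, 0 ≤ d x y) {y₀ : X → Y}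
    (hy₀ : ∀ x, d x (y₀ x) = 0) (hD : 0 ≤ D) (P : PMF (X × Z)) {q : X × Z → ℝ}
    (hq : q ∈ stdSimplex ℝ (X × Z)) (hqP : ∀ a, P a = 0 → q a = 0)
    (hmax : ∀ q' ∈ stdSimplex ℝ (X × Z), (∀ a, P a = 0 → q' a = 0) →
      rate d D q' - klFn P q' ≤ rate d D q - klFn P q) :
    deceptionExponent d D P = (rate d D q - klFn P q : ℝ) := by
  set E := rate d D q - klFn P q with hE
  have hscale : ∀ {n : ℕ} (r : ℝ), 0 < n →
      ((1 / (n : ℝ) : ℝ) : EReal) * ENNReal.log (ENNReal.ofReal (Real.exp (n * r))) = r := by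
    intro n r hn
    have hn' : (n : ℝ) ≠ 0 := by exact_mod_cast hn.ne'
    rw [ENNReal.log_ofReal_of_pos (Real.exp_pos _), Real.log_exp, ← EReal.coe_mul]
    congr 1
    field_simp
  apply le_antisymm
  · refine EReal.le_of_forall_lt_iff_le.1 fun t ht => ?_
    have ht' : E < t := EReal.coe_lt_coe_iff.1 ht
    refine Filter.liminf_le_of_frequently_le' (Filter.Eventually.frequently ?_)
    filter_upwards [eventually_exists_strategy hd hy₀ hD P hmax (t - E) (sub_pos.2 ht'),
      Filter.eventually_gt_atTop 0] with n ⟨S, hS⟩ hn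
    rw [← hscale t hn]
    refine mul_le_mul_of_nonneg_left ?_ (EReal.coe_nonneg.2 (by positivity))
    refine (iInf_le _ S).trans (ENNReal.log_le_log ?_)
    rwa [add_sub_cancel] at hS
  · refine EReal.ge_of_forall_gt_iff_ge.1 fun t ht => ?_
    have ht' : t < E := EReal.coe_lt_coe_iff.1 ht
    refine Filter.le_liminf_of_le (by isBoundedDefault) ?_
    filter_upwards [eventually_le_expectedCount hd hy₀ hD P hq hqP (E - t) (sub_pos.2 ht'),
      Filter.eventually_gt_atTop 0] with n hS hn
    rw [← hscale t hn]
    refine mul_le_mul_of_nonneg_left ?_ (EReal.coe_nonneg.2 (by positivity))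
    refine le_iInf fun S => ENNReal.log_le_log ?_
    have := hS S
    rwa [← hE, sub_sub_cancel] at this

theorem isGreatest_deceptionExponent {d : X → Y → ℝ} {D : ℝ} (hd : ∀ x y, 0 ≤ d x y) {y₀ : X → Y}
    (hy₀ : ∀ x, d x (y₀ x) = 0) (hD : 0 ≤ D) (P : PMF (X × Z)) :
    IsGreatest (Set.range fun Q : PMF (X × Z) => condRateDist d D Q - (relEntropy Q P : EReal))
      (deceptionExponent d D P) := by
  obtain ⟨q, ⟨hq, hqP⟩, hmax⟩ := exists_isMaxOn_rate_sub_klFn hd hy₀ hD P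
  rw [deceptionExponent_eq hd hy₀ hD P hq hqP fun q' hq' hqP' => hmax q' ⟨hq', hqP'⟩]
  constructor
  · obtain ⟨Q, rfl⟩ := exists_realMass_eq hq
    refine ⟨Q, ?_⟩
    dsimp only
    rw [condRateDist_eq_rate hd hy₀ hD,
      relEntropy_eq_klFn fun a ha => (realMass_eq_zero_iff Q a).1 (hqP a ha), EReal.coe_sub]
  · rintro _ ⟨Q, rfl⟩
    dsimp only
    by_cases hQ : ∀ a, P a = 0 → Q a = 0
    · rw [condRateDist_eq_rate hd hy₀ hD, relEntropy_eq_klFn hQ, ← EReal.coe_sub,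
        EReal.coe_le_coe_iff]
      exact hmax _ ⟨realMass_mem_stdSimplex Q, fun a ha => (realMass_eq_zero_iff Q a).2 (hQ a ha)⟩
    · -- here the relative entropy is `∞`, and a real number minus `∞` is `-∞`
      rw [relEntropy_eq_top hQ, EReal.coe_ennreal_top, EReal.sub_top]
      exact bot_le

end Exponent

end SideInfoGuessing

theorem theorem2 {X Y Z : Type*} [Fintype X] [Fintype Y] [Fintype Z]
    (P : PMF (X × Z)) (d : X → Y → ℝ) (hd : ∀ x y, 0 ≤ d x y) (hd0 : ∀ x, ∃ y, d x y = 0)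
    (D : ℝ) (hD : 0 ≤ D) :
    (∀ Q : PMF (X × Z), IsLeast (SideInfoGuessing.feasibleInfo d D Q)
      (SideInfoGuessing.condRateDist d D Q)) ∧
    IsGreatest
      (Set.range fun Q : PMF (X × Z) =>
        SideInfoGuessing.condRateDist d D Q - (SideInfoGuessing.relEntropy Q P : EReal))
      (SideInfoGuessing.deceptionExponent d D P) := by
  choose y₀ hy₀ using hd0
  refine ⟨fun Q => ?_, SideInfoGuessing.isGreatest_deceptionExponent hd hy₀ hD P⟩
  rw [SideInfoGuessing.condRateDist_eq_rate hd hy₀ hD]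
  exact SideInfoGuessing.isLeast_feasibleInfo hd hy₀ hD Q
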